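/- A loop is a set $Q$ with a multiplication and a two-sided identity $1$ such that all left translations $L_a\colon b\mapsto ab$ and right translations $R_a\colon b\mapsto ba$ are bijections. Its multiplication group is generated by all $L_a$, $R_a$; its inner mapping group $\mathrm{Inn}(Q)$ is the stabilizer of $1$ in the multiplication group; $Q$ is automorphic if every inner mapping is an automorphism of $Q$. The associator $(a,b,c)$ is the unique element with $(ab)c=(a(bc))(a,b,c)$. The associator subloop $A(Q)$ is the least normal subloop containing all associators. The left, middle and right nucleus $N_\lambda(Q)$, $N_\mu(Q)$, $N_\rho(Q)$ consist of all $a\in Q$ with $(a,b,c)=1$, respectively $(b,a,c)=1$, respectively $(b,c,a)=1$, for all $b,c\in Q$; the nucleus is $N(Q)=N_\lambda(Q)\cap N_\mu(Q)\cap N_\rho(Q)$; the center $Z(Q)$ consists of the elements fixed by $\mathrm{Inn}(Q)$. Let $Z_0(Q)=1$ and let $Z_{i+1}(Q)$ be the preimage of $Z(Q/Z_i(Q))$ in $Q$; $Q$ has nilpotency class $n$ if $Z_{n-1}(Q)\ne Q=Z_n(Q)$. Put $\alpha(n)=(n^3-n)/3$, $\beta(n)=n^2-n$ for $n\in\mathbb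 Z$, and let $*$ be the multiplication on $\mathbb Z^8$ given by $(a_1,\dots,a_8)*(b_1,\dots,b_8)=(c_1,\dots,c_8)$, where \begin{align*} c_1={}&a_1+b_1,\qquad c_2=a_2+b_2,\\ c_3={}&a_3+b_3-a_1b_1(a_2+b_2),\qquad c_4=a_4+b_4+a_2b_2(a_1+b_1),\\ c_5={}&a_5+b_5+(a_2+b_2)(b_1\alpha(a_1)+a_1\alpha(b_1))+a_2(a_1\beta(b_1)+b_1^2\beta(a_1))\\ &+b_2(b_1\beta(a_1)+a_1^2\beta(b_1))-a_1b_1(a_3+b_3),\\ c_6={}&a_6+b_6+2a_1a_2b_1b_2(a_1+b_1)+(a_2+b_2)(a_1\beta(b_1)+b_1\beta(a_1))\\ &+(\beta(a_2)+\beta(b_2))(a_1b_1^2+b_1a_1^2)-a_2b_2\alpha(a_1+b_1)\\ &-a_1b_1(a_4+b_4)-(a_3+b_3)(a_1b_2+a_2b_1),\\ c_7={}&a_7+b_7-2a_1a_2b_1b_2(a_2+b_2)-(a_1+b_1)(a_2\beta(b_2)+b_2\beta(a_2))\\ &-(\beta(a_1)+\beta(b_1))(a_2b_2^2+b_2a_2^2)+a_1b_1\alpha(a_2+b_2)\\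 &-a_2b_2(a_3+b_3)-(a_4+b_4)(a_1b_2+a_2b_1),\\ c_8={}&a_8+b_8-(a_1+b_1)(a_2\alpha(b_2)+b_2\alpha(a_2))-a_1(a_2\beta(b_2)+b_2^2\beta(a_2))\\ &-b_1(b_2\beta(a_2)+a_2^2\beta(b_2))-a_2b_2(a_4+b_4). \end{align*} Then $Q=(\mathbb Z^8,*)$ is a loop, and it is the free commutative automorphic loop $F_3(x,y)$ of nilpotency class $3$ on the free generators $x=(1,0,\dots,0)$ and $y=(0,1,0,\dots,0)$: it is a commutative automorphic loop of nilpotency class $3$, and for all elements $a,b$ of a commutative automorphic loop $L$ of nilpotency class at most $3$ there is a unique homomorphism $Q\to L$ with $x\mapsto a$, $y\mapsto b$. With $u_1=(x,x,y)$, $u_2=(x,y,y)$, $v_1=(x,x,u_1)$, $v_2=(x,x,u_2)$, $v_3=(y,y,u_1)$, $v_4=(y,y,u_2)$ (associators in $Q$), every $(a_1,\dots,a_8)\in Q$ equals $(x^{a_1}y^{a_2}\cdot u_1^{a_3}u_2^{a_4})\cdot v_1^{a_5}v_2^{a_6}v_3^{a_7}v_4^{a_8}$. Moreover, $$A(Q)=N_\mu(Q)=0\times0\times\mathbb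 Z^6,\qquad N_\lambda(Q)=N_\rho(Q)=N(Q)=Z(Q)=0\times0\times0\times0\times\mathbb Z^4.$$ -/

import Mathlib

universe u v

namespace CALoop

/-- A loop: a set with a multiplication and a two-sided identity element, all of whose left and
right translations are bijections. -/
class IsLoop (Q : Type u) [MulOneClass Q] : Prop where
  mul_left_bijective : ∀ a : Q, Function.Bijective (fun b : Q => a * b)
  mul_right_bijective : ∀ a : Q, Function.Bijective (fun b : Q => b * a)

section Loop

variable (Q : Type u) [MulOneClass Q] [IsLoop Q]

variable {Q} in
/-- The left translation `b ↦ a * b`. -/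
noncomputable def leftTranslation (a : Q) : Equiv.Perm Q :=
  Equiv.ofBijective (fun b : Q => a * b) (IsLoop.mul_left_bijective a)

variable {Q} in
/-- The right translation `b ↦ b * a`. -/
noncomputable def rightTranslation (a : Q) : Equiv.Perm Q :=
  Equiv.ofBijective (fun b : Q => b * a) (IsLoop.mul_right_bijective a)

variable {Q} in
/-- Left division: the unique `c` with `a * c = b`. -/
noncomputable def ldiv (a b : Q) : Q := (leftTranslation a).symm b

variable {Q} in
/-- Right division: the unique `c` with `c * a = b`. -/
noncomputable def rdiv (b a : Q) : Q := (rightTranslation a).symm b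

variable {Q} in
/-- The associator `(a, b, c)`: the unique element with
`(a * b) * c = (a * (b * c)) * (a, b, c)`. -/
noncomputable def associator (a b c : Q) : Q := ldiv (a * (b * c)) (a * b * c)

variable {Q} in
theorem mul_ldiv (a b : Q) : a * ldiv a b = b :=
  (leftTranslation a).apply_symm_apply b

variable {Q} in
theorem rdiv_mul (b a : Q) : rdiv b a * a = b :=
  (rightTranslation a).apply_symm_apply b

variable {Q} in
theorem mul_associator (a b c : Q) : a * (b * c) * associator a b c = a * b * c :=
  mul_ldiv _ _

variable {Q} in
/-- The integer power `x ^ n`, as the value at `1` of the `n`-th power of the left translation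
by `x`. -/
noncomputable def lpow (x : Q) (n : ℤ) : Q := (leftTranslation x ^ n) 1

/-- The multiplication group, generated by all left and right translations. -/
noncomputable def multiplicationGroup : Subgroup (Equiv.Perm Q) :=
  Subgroup.closure (Set.range leftTranslation ∪ Set.range rightTranslation)

/-- The inner mapping group: the stabilizer of `1` in the multiplication group. -/
noncomputable def innerMappingGroup : Subgroup (Equiv.Perm Q) :=
  multiplicationGroup Q ⊓ MulAction.stabilizer (Equiv.Perm Q) (1 : Q)

/-- Every inner mapping is an automorphism. -/
def IsAutomorphic : Prop :=
  ∀ φ ∈ innerMappingGroup Q, ∀ a b : Q, φ (a * b) = φ a * φ b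

/-- The center: the elements fixed by all inner mappings. -/
def center : Set Q := {a | ∀ φ ∈ innerMappingGroup Q, φ a = a}

/-- The center consists of the elements that commute and associate with all elements. -/
theorem center_eq_setCenter : center Q = Set.center Q := by
  ext a
  have hL : ∀ b : Q, leftTranslation b ∈ multiplicationGroup Q := fun b =>
    Subgroup.subset_closure (Or.inl ⟨b, rfl⟩)
  have hR : ∀ b : Q, rightTranslation b ∈ multiplicationGroup Q := fun b =>
    Subgroup.subset_closure (Or.inr ⟨b, rfl⟩)
  have aL : ∀ b c : Q, leftTranslation b c = b * c := fun _ _ => rfl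
  have aR : ∀ b c : Q, rightTranslation b c = c * b := fun _ _ => rfl
  have key : ∀ φ ψ : Equiv.Perm Q, φ ∈ multiplicationGroup Q → ψ ∈ multiplicationGroup Q →
      φ 1 = ψ 1 → a ∈ center Q → φ a = ψ a := by
    intro φ ψ hφ hψ h1 ha
    have hm : ψ⁻¹ * φ ∈ innerMappingGroup Q := by
      refine Subgroup.mem_inf.2 ⟨mul_mem (inv_mem hψ) hφ, MulAction.mem_stabilizer_iff.2 ?_⟩
      rw [Equiv.Perm.smul_def, Equiv.Perm.mul_apply, h1]
      exact ψ.symm_apply_apply 1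
    have := ha _ hm
    rw [Equiv.Perm.mul_apply, Equiv.Perm.inv_eq_iff_eq] at this
    exact this
  constructor
  · intro ha
    refine ⟨fun b => ?_, fun b c => ?_, fun b c => ?_⟩
    · have := key _ _ (hR b) (hL b) (by simp [aL, aR]) ha
      exact this
    · have := key _ _ (hR (b * c)) (mul_mem (hR c) (hR b)) (by simp [aR]) ha
      simpa [aR] using this
    · have := key _ _ (hL (b * c)) (mul_mem (hL b) (hL c)) (by simp [aL]) ha
      simpa [aL] using this
  · intro ha φ hφ
    have h : ∀ u : Q, φ (u * a) = φ u * a := by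
      refine Subgroup.closure_induction (p := fun φ _ => ∀ u : Q, φ (u * a) = φ u * a)
        ?_ ?_ ?_ ?_ hφ.1
      · rintro _ (⟨b, rfl⟩ | ⟨b, rfl⟩) u
        · rw [aL, aL, ha.right_assoc]
        · rw [aR, aR, ha.right_assoc, ← (ha.comm b).eq, ha.mid_assoc]
      · intro u
        rfl
      · intro φ ψ _ _ h1 h2 u
        rw [Equiv.Perm.mul_apply, h2, h1, Equiv.Perm.mul_apply]
      · intro φ _ h1 u
        rw [Equiv.Perm.inv_eq_iff_eq, h1]
        exact congrArg (· * a) (φ.apply_symm_apply u).symm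
    have h1 : φ 1 = 1 := hφ.2
    simpa [h1] using h 1

variable {Q} in
/-- `u` and `v` lie in the same coset: `u S = v S`, that is, `u = v * s` with `s ∈ S`. -/
def EqMod (S : Set Q) (u v : Q) : Prop := ldiv v u ∈ S

/-- The upper central series. `Z 0 = 1`, and `Z (i + 1)` is the preimage of the center of
`Q / Z i`: it consists of the `a` whose coset commutes and associates with all cosets of
`Z i`. -/
def upperCentral : ℕ → Set Q
  | 0 => {1}
  | i + 1 => {a | ∀ b c : Q,
      EqMod (upperCentral i) (a * b) (b * a) ∧
      EqMod (upperCentral i) (a * b * c) (a * (b * c)) ∧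
      EqMod (upperCentral i) (b * a * c) (b * (a * c)) ∧
      EqMod (upperCentral i) (b * c * a) (b * (c * a))}

theorem upperCentral_one : upperCentral Q 1 = center Q := by
  have e : ∀ u w : Q, ldiv w u = 1 ↔ u = w := by
    intro u w
    refine ⟨fun h => ?_, fun h => ?_⟩
    · rw [← mul_ldiv w u, h, mul_one]
    · apply (IsLoop.mul_left_bijective w).1
      change w * ldiv w u = w * 1
      rw [mul_ldiv, h, mul_one]
  rw [center_eq_setCenter]
  ext a
  simp only [upperCentral, EqMod, Set.mem_ofPred_eq, Set.mem_singleton_iff, e]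
  constructor
  · intro h
    exact ⟨fun b => (h b b).1, fun b c => (h b c).2.1.symm, fun b c => (h b c).2.2.2⟩
  · intro h b c
    exact ⟨h.comm b, (h.left_assoc b c).symm, h.mid_assoc b c, h.right_assoc b c⟩

/-- Nilpotency class at most `n`. -/
def NilpotentOfClassLE (n : ℕ) : Prop := upperCentral Q n = Set.univ

/-- Nilpotency class (exactly) `n`, for `1 ≤ n`. -/
def NilpotentOfClass (n : ℕ) : Prop :=
  upperCentral Q (n - 1) ≠ Set.univ ∧ upperCentral Q n = Set.univ

/-- Commutative automorphic loops. -/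
def IsCommAutomorphic : Prop := (∀ a b : Q, a * b = b * a) ∧ IsAutomorphic Q

variable {Q} in
/-- `Q` is the free commutative automorphic loop of nilpotency class `n` on the free
generators `x`, `y`: it is a commutative automorphic loop of nilpotency class `n`, and for all
elements `a`, `b` of a commutative automorphic loop `L` of nilpotency class at most `n` there
is a unique homomorphism `Q → L` with `x ↦ a` and `y ↦ b`. -/
def IsFreeOn (n : ℕ) (x y : Q) : Prop :=
  IsCommAutomorphic Q ∧ NilpotentOfClass Q n ∧
    ∀ (L : Type v) [MulOneClass L] [IsLoop L], IsCommAutomorphic L → NilpotentOfClassLE L n →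
      ∀ a b : L, ∃! f : Q →* L, f x = a ∧ f y = b

variable {Q} in
/-- Subloops. -/
structure IsSubloop (S : Set Q) : Prop where
  one_mem : (1 : Q) ∈ S
  mul_mem : ∀ a ∈ S, ∀ b ∈ S, a * b ∈ S
  ldiv_mem : ∀ a ∈ S, ∀ b ∈ S, ldiv a b ∈ S
  rdiv_mem : ∀ a ∈ S, ∀ b ∈ S, rdiv a b ∈ S

variable {Q} in
/-- Normal subloops: the subloops that are invariant under all inner mappings. -/
def IsNormalSubloop (S : Set Q) : Prop :=
  IsSubloop S ∧ ∀ φ ∈ innerMappingGroup Q, ∀ s ∈ S, φ s ∈ S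

/-- The associator subloop: the least normal subloop containing all associators. -/
def associatorSubloop : Set Q :=
  ⋂₀ {S : Set Q | IsNormalSubloop S ∧ ∀ a b c : Q, associator a b c ∈ S}

/-- The left nucleus. -/
def leftNucleus : Set Q := {a | ∀ b c : Q, associator a b c = 1}

/-- The middle nucleus. -/
def middleNucleus : Set Q := {a | ∀ b c : Q, associator b a c = 1}

/-- The right nucleus. -/
def rightNucleus : Set Q := {a | ∀ b c : Q, associator b c a = 1}

/-- The nucleus. -/
def nucleus : Set Q := leftNucleus Q ∩ middleNucleus Q ∩ rightNucleus Q

end Loop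

/-- `α n = (n ^ 3 - n) / 3`; the division is exact. -/
def α (n : ℤ) : ℤ := (n ^ 3 - n) / 3

/-- `β n = n ^ 2 - n`. -/
def β (n : ℤ) : ℤ := n ^ 2 - n

/-- The set `ℤ ^ 8`, which carries the multiplication `*` below. -/
@[ext]
structure Z8 where
  c1 : ℤ
  c2 : ℤ
  c3 : ℤ
  c4 : ℤ
  c5 : ℤ
  c6 : ℤ
  c7 : ℤ
  c8 : ℤ

namespace Z8

/-- The multiplication of exponents. -/
def mul (a b : Z8) : Z8 where
  c1 := a.c1 + b.c1
  c2 := a.c2 + b.c2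
  c3 := a.c3 + b.c3 - a.c1 * b.c1 * (a.c2 + b.c2)
  c4 := a.c4 + b.c4 + a.c2 * b.c2 * (a.c1 + b.c1)
  c5 := a.c5 + b.c5 + (a.c2 + b.c2) * (b.c1 * α a.c1 + a.c1 * α b.c1)
    + a.c2 * (a.c1 * β b.c1 + b.c1 ^ 2 * β a.c1)
    + b.c2 * (b.c1 * β a.c1 + a.c1 ^ 2 * β b.c1)
    - a.c1 * b.c1 * (a.c3 + b.c3)
  c6 := a.c6 + b.c6 + 2 * a.c1 * a.c2 * b.c1 * b.c2 * (a.c1 + b.c1)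
    + (a.c2 + b.c2) * (a.c1 * β b.c1 + b.c1 * β a.c1)
    + (β a.c2 + β b.c2) * (a.c1 * b.c1 ^ 2 + b.c1 * a.c1 ^ 2)
    - a.c2 * b.c2 * α (a.c1 + b.c1)
    - a.c1 * b.c1 * (a.c4 + b.c4)
    - (a.c3 + b.c3) * (a.c1 * b.c2 + a.c2 * b.c1)
  c7 := a.c7 + b.c7 - 2 * a.c1 * a.c2 * b.c1 * b.c2 * (a.c2 + b.c2)
    - (a.c1 + b.c1) * (a.c2 * β b.c2 + b.c2 * β a.c2)
    - (β a.c1 + β b.c1) * (a.c2 * b.c2 ^ 2 + b.c2 * a.c2 ^ 2)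
    + a.c1 * b.c1 * α (a.c2 + b.c2)
    - a.c2 * b.c2 * (a.c3 + b.c3)
    - (a.c4 + b.c4) * (a.c1 * b.c2 + a.c2 * b.c1)
  c8 := a.c8 + b.c8 - (a.c1 + b.c1) * (a.c2 * α b.c2 + b.c2 * α a.c2)
    - a.c1 * (a.c2 * β b.c2 + b.c2 ^ 2 * β a.c2)
    - b.c1 * (b.c2 * β a.c2 + a.c2 ^ 2 * β b.c2)
    - a.c2 * b.c2 * (a.c4 + b.c4)

theorem α_zero : α 0 = 0 := by decide

theorem β_zero : β 0 = 0 := by decide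

theorem mul_comm' (a b : Z8) : mul a b = mul b a := by
  have h1 : α (b.c1 + a.c1) = α (a.c1 + b.c1) := by rw [add_comm]
  have h2 : α (b.c2 + a.c2) = α (a.c2 + b.c2) := by rw [add_comm]
  ext <;> simp only [mul, h1, h2] <;> ring

instance : MulOneClass Z8 where
  mul := mul
  one := ⟨0, 0, 0, 0, 0, 0, 0, 0⟩
  one_mul a := by
    change mul ⟨0, 0, 0, 0, 0, 0, 0, 0⟩ a = a
    ext <;> simp [mul, α_zero, β_zero]
  mul_one a := by
    change mul a ⟨0, 0, 0, 0, 0, 0, 0, 0⟩ = a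
    ext <;> simp [mul, α_zero, β_zero]

theorem mul_left_bijective (a : Z8) : Function.Bijective (fun b : Z8 => mul a b) := by
  constructor
  · rintro ⟨b1, b2, b3, b4, b5, b6, b7, b8⟩ ⟨d1, d2, d3, d4, d5, d6, d7, d8⟩ h
    simp only [mul, Z8.mk.injEq, add_right_inj] at h
    obtain ⟨rfl, rfl, h3, h4, h5, h6, h7, h8⟩ := h
    obtain rfl : b3 = d3 := by linarith
    obtain rfl : b4 = d4 := by linarith
    ext <;> simp only [] <;> linarith
  · intro c
    let s : Z8 := mul a ⟨c.c1 - a.c1, c.c2 - a.c2, 0, 0, 0, 0, 0, 0⟩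
    let t : Z8 := mul a ⟨c.c1 - a.c1, c.c2 - a.c2, c.c3 - s.c3, c.c4 - s.c4, 0, 0, 0, 0⟩
    refine ⟨⟨c.c1 - a.c1, c.c2 - a.c2, c.c3 - s.c3, c.c4 - s.c4,
      c.c5 - t.c5, c.c6 - t.c6, c.c7 - t.c7, c.c8 - t.c8⟩, ?_⟩
    ext <;> simp only [mul, s, t] <;> ring

instance : IsLoop Z8 where
  mul_left_bijective := mul_left_bijective
  mul_right_bijective a := by
    have h : (fun b : Z8 => b * a) = fun b : Z8 => mul a b := by
      funext b
      exact mul_comm' b a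
    rw [h]
    exact mul_left_bijective a

/-- The element of `ℤ ^ 8` that corresponds to the free generator `x`. -/
def x : Z8 := ⟨1, 0, 0, 0, 0, 0, 0, 0⟩

/-- The element of `ℤ ^ 8` that corresponds to the free generator `y`. -/
def y : Z8 := ⟨0, 1, 0, 0, 0, 0, 0, 0⟩

end Z8

/-- The word `(x ^ a₁ y ^ a₂ · u₁ ^ a₃ u₂ ^ a₄) · v₁ ^ a₅ v₂ ^ a₆ v₃ ^ a₇ v₄ ^ a₈`, where
`u₁ = (x, x, y)`, `u₂ = (x, y, y)`, `v₁ = (x, x, u₁)`, `v₂ = (x, x, u₂)`, `v₃ = (y, y, u₁)`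
and `v₄ = (y, y, u₂)`. -/
noncomputable def canonicalWord {Q : Type u} [MulOneClass Q] [IsLoop Q] (x y : Q) (a : Z8) : Q :=
  let u₁ := associator x x y
  let u₂ := associator x y y
  let v₁ := associator x x u₁
  let v₂ := associator x x u₂
  let v₃ := associator y y u₁
  let v₄ := associator y y u₂
  ((lpow x a.c1 * lpow y a.c2) * (lpow u₁ a.c3 * lpow u₂ a.c4)) *
    (((lpow v₁ a.c5 * lpow v₂ a.c6) * lpow v₃ a.c7) * lpow v₄ a.c8)

end CALoop

/-!
Write `θ_{a,b} = L_{ab}⁻¹ L_a L_b`, so that `(a b) θ_{a,b}(c) = a (b c)`. These mappings generate the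
inner mapping group of a commutative loop (`isAutomorphic_of_innerMap_mul`), so `ℤ ^ 8` is
automorphic by an explicit formula for `θ_{a,b}(c)` and polynomial identities
(`Z8.isCommAutomorphic`). Its nuclei, center, upper central series and associator subloop are read
off from the coordinates of associators, and its canonical words are evaluated directly.

The content is the existence of homomorphisms to a commutative automorphic loop `L` of class at
most three. As the `θ_{a,b}` are automorphisms, associators with an entry in the second center are
central and multiplicative in each entry. Let `K` (`AssocKernel`) consist of the elements of the
second center that every map `(u, ·, c)` and `(u, c, ·)` kills. It contains the center and all
associators, it is an abelian group, and it acts on `L` by multiplication, with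
`(a k) (b l) = (a b) (k l (k, a, b) (l, b, a))`. All computations in `L` are thereby linear
computations in `K`, which is written additively.

Fix `x, y ∈ L`. Conjugating inner mappings by `θ_{x,y}`, which fixes `x`, gives the symmetry
`(u, x, y) = (u, y, x)` for `u = (x, x, y)` (`assocHom_assocK_comm`), and applying `θ_{x,y}` to
`(x, x, y)` gives `((x, x, y), y, x) = ((x, y, y), x, x)` (`assocHom_assocK_exchange`). With these,
evaluating the automorphisms `θ_{x,x}` and `θ_{w,x}` on powers yields the product of `x` with
`x ^ i y ^ j` (`mul_lpow_mul_lpow`), and exchanging `x` and `y` the product of `y` with it. So the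
map `f : ℤ ^ 8 → L` given by the canonical words satisfies `f (g t) = f g f t` whenever the first
two exponents of `g` are `(0, 0)`, `(1, 0)` or `(0, 1)`. The set of these `g` is invariant under
inner mappings and generates `ℤ ^ 8`. This forces `f` to be a homomorphism, without computing any
further product (`map_mul_of_generating`): `f` intertwines `θ_{g,s}` with `θ_{f g,f s}`, and hence
the `s` with `f (s t) = f s f t` for all `t` are closed under multiplication and division by `g`.
-/

namespace CALoop

/-! ### Inner mappings of commutative loops -/

section Loop

variable {L : Type v} [MulOneClass L] [IsLoop L]

theorem mul_left_cancel_of_isLoop {a b c : L} (h : a * b = a * c) : b = c :=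
  (IsLoop.mul_left_bijective a).1 h

theorem ldiv_eq_iff {a b c : L} : ldiv a b = c ↔ a * c = b :=
  ⟨fun h => h ▸ mul_ldiv a b, fun h => mul_left_cancel_of_isLoop ((mul_ldiv a b).trans h.symm)⟩

theorem associator_eq_iff {a b c z : L} : associator a b c = z ↔ a * (b * c) * z = a * b * c :=
  ldiv_eq_iff

theorem associator_eq_one_iff {a b c : L} : associator a b c = 1 ↔ a * (b * c) = a * b * c := by
  rw [associator_eq_iff, mul_one]

theorem leftTranslation_mem (a : L) : leftTranslation a ∈ multiplicationGroup L :=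
  Subgroup.subset_closure (Or.inl ⟨a, rfl⟩)

/-- The inner mapping `L_{ab}⁻¹ L_a L_b`. -/
noncomputable def innerMap (a b : L) : Equiv.Perm L :=
  (leftTranslation (a * b))⁻¹ * (leftTranslation a * leftTranslation b)

theorem mul_innerMap (a b c : L) : a * b * innerMap a b c = a * (b * c) :=
  (leftTranslation (a * b)).apply_symm_apply _

theorem innerMap_eq_iff {a b c d : L} : innerMap a b c = d ↔ a * b * d = a * (b * c) :=
  ⟨fun h => h ▸ mul_innerMap a b c,
    fun h => mul_left_cancel_of_isLoop ((mul_innerMap a b c).trans h.symm)⟩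

theorem innerMap_one (a b : L) : innerMap a b 1 = 1 := by
  rw [innerMap_eq_iff, mul_one, mul_one]

theorem innerMap_mem (a b : L) : innerMap a b ∈ innerMappingGroup L := by
  refine Subgroup.mem_inf.2 ⟨mul_mem (inv_mem (leftTranslation_mem _))
    (mul_mem (leftTranslation_mem _) (leftTranslation_mem _)), ?_⟩
  exact MulAction.mem_stabilizer_iff.2 (innerMap_one a b)

theorem innerMap_mul (h : IsAutomorphic L) (a b c d : L) :
    innerMap a b (c * d) = innerMap a b c * innerMap a b d :=
  h _ (innerMap_mem a b) c d

/-- The inner mapping group of a commutative loop is generated by the mappings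
`L_{ab}⁻¹ L_a L_b`, so it suffices to test these for being automorphisms. -/
theorem isAutomorphic_of_innerMap_mul (hc : ∀ a b : L, a * b = b * a)
    (h : ∀ a b c d : L, innerMap a b (c * d) = innerMap a b c * innerMap a b d) :
    IsAutomorphic L := by
  let A : Subgroup (Equiv.Perm L) :=
    { carrier := {φ | ∀ c d, φ (c * d) = φ c * φ d}
      one_mem' := fun _ _ => rfl
      mul_mem' := fun {φ ψ} hφ hψ c d => by
        rw [Equiv.Perm.mul_apply, hψ, hφ]; rfl
      inv_mem' := fun {φ} hφ c d => by
        rw [Equiv.Perm.inv_eq_iff_eq, hφ]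
        simp }
  -- The `φ` such that all `L_{φ w}⁻¹ φ L_w` are automorphisms form a group, which contains the
  -- translations by assumption; for an inner mapping `φ` take `w = 1`.
  have key : ∀ φ ∈ multiplicationGroup L, ∀ w : L,
      (leftTranslation (φ w))⁻¹ * (φ * leftTranslation w) ∈ A := by
    intro φ hφ
    have hL : ∀ a w : L, (leftTranslation (leftTranslation a w))⁻¹ *
        (leftTranslation a * leftTranslation w) ∈ A := fun a w => h a w
    refine Subgroup.closure_induction (p := fun φ _ => ∀ w : L,
      (leftTranslation (φ w))⁻¹ * (φ * leftTranslation w) ∈ A) ?_ ?_ ?_ ?_ hφ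
    · rintro _ (⟨a, rfl⟩ | ⟨a, rfl⟩) w
      · exact hL a w
      · have e : rightTranslation a = leftTranslation a := by
          ext b; exact hc b a
        rw [e]
        exact hL a w
    · intro w
      simp
    · intro φ ψ _ _ h1 h2 w
      have := mul_mem (h1 (ψ w)) (h2 w)
      rw [Equiv.Perm.mul_apply]
      convert this using 1
      group
    · intro φ _ h1 w
      have := inv_mem (h1 (φ⁻¹ w))
      rw [show φ (φ⁻¹ w) = w from φ.apply_symm_apply w] at this
      convert this using 1
      group
  intro φ hφ
  have h1 : φ 1 = 1 := hφ.2
  have h2 : leftTranslation (1 : L) = 1 := by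
    ext b; exact one_mul b
  have := key φ hφ.1 1
  rw [h1, h2, inv_one, one_mul, mul_one] at this
  exact this

/-- Inner mappings preserve every homomorphism to `ℤ`. -/
theorem character_innerMapping_apply {Q : Type u} [MulOneClass Q] [IsLoop Q] (χ : Q → ℤ)
    (hχ : ∀ a b, χ (a * b) = χ a + χ b) {φ : Equiv.Perm Q} (hφ : φ ∈ innerMappingGroup Q)
    (t : Q) : χ (φ t) = χ t := by
  have h1 : χ 1 = 0 := by
    have := hχ 1 1
    rw [mul_one] at this
    omega
  have key : ∀ t, χ (φ t) = χ (φ 1) + χ t := by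
    refine Subgroup.closure_induction (p := fun φ _ => ∀ t, χ (φ t) = χ (φ 1) + χ t)
      ?_ ?_ ?_ ?_ hφ.1
    · rintro _ (⟨a, rfl⟩ | ⟨a, rfl⟩) t
      · change χ (a * t) = χ (a * 1) + χ t
        rw [hχ, mul_one]
      · change χ (t * a) = χ (1 * a) + χ t
        rw [hχ, one_mul, add_comm]
    · intro t
      simp [h1]
    · intro φ ψ _ _ h1 h2 t
      simp only [Equiv.Perm.mul_apply]
      rw [h1 (ψ t), h2 t, h1 (ψ 1)]
      ring
    · intro φ _ h2 t
      have e1 := h2 (φ⁻¹ t)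
      have e2 := h2 (φ⁻¹ 1)
      rw [show ∀ w, φ (φ⁻¹ w) = w from φ.apply_symm_apply] at e1 e2
      omega
  have e : φ 1 = 1 := hφ.2
  rw [key, e, h1, zero_add]

theorem upperCentral_one_eq : upperCentral L 1 = Set.center L := by
  rw [upperCentral_one, center_eq_setCenter]

/-- In a commutative loop, the upper central series is described by associators alone. -/
theorem mem_upperCentral_succ_iff (hc : ∀ a b : L, a * b = b * a) {n : ℕ}
    (h1 : (1 : L) ∈ upperCentral L n) {a : L} :
    a ∈ upperCentral L (n + 1) ↔ ∀ b c, associator a b c ∈ upperCentral L n ∧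
      associator b a c ∈ upperCentral L n ∧ associator b c a ∈ upperCentral L n := by
  refine ⟨fun h b c => (h b c).2, fun h b c => ⟨?_, h b c⟩⟩
  have e : ldiv (b * a) (a * b) = 1 := ldiv_eq_iff.2 (by rw [mul_one, hc])
  unfold EqMod
  rwa [e]

end Loop

/-- A map `f` between commutative automorphic loops is a homomorphism as soon as
`f (g t) = f g f t` for all `g` in a set `G` that is invariant under inner mappings and from which
every element is reached, starting at `1`, by multiplications and divisions by elements of `G`. -/
theorem map_mul_of_generating {Q : Type u} {L : Type v} [MulOneClass Q] [IsLoop Q]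
    [MulOneClass L] [IsLoop L] (hQ : IsCommAutomorphic Q) (hL : IsCommAutomorphic L) (f : Q → L)
    (hf1 : f 1 = 1) (G : Set Q) (hfG : ∀ g ∈ G, ∀ t, f (g * t) = f g * f t)
    (hG : ∀ φ ∈ innerMappingGroup Q, ∀ g ∈ G, φ g ∈ G)
    (hgen : ∀ S : Set Q, 1 ∈ S → (∀ g ∈ G, ∀ s, s ∈ S ↔ g * s ∈ S) → S = Set.univ)
    (s t : Q) : f (s * t) = f s * f t := by
  -- `f` intertwines the inner mapping of `g, s` with that of `f g, f s`.
  have inter : ∀ g ∈ G, ∀ s t, f (innerMap g s t) = innerMap (f g) (f s) (f t) := by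
    intro g hg s
    -- For `t ∈ G` this follows by expanding `f (g (s t)) = f ((g s) θ(t))` in both ways.
    have hgG : ∀ p ∈ G, f (innerMap g s p) = innerMap (f g) (f s) (f p) := by
      intro p hp
      have hp' := hG _ (innerMap_mem g s) p hp
      symm
      rw [innerMap_eq_iff, ← hfG g hg, hL.1 (f s), ← hfG p hp, ← hfG g hg, hQ.1 p s,
        ← mul_innerMap g s p, hQ.1 (g * s), hfG _ hp', hL.1]
    have hS := hgen {t | f (innerMap g s t) = innerMap (f g) (f s) (f t)}
      (by simp only [Set.mem_ofPred_eq, innerMap_one, hf1]) (by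
        intro p hp t
        have hp' := hG _ (innerMap_mem g s) p hp
        simp only [Set.mem_ofPred_eq]
        rw [innerMap_mul hQ.2, hfG _ hp', hfG p hp, innerMap_mul hL.2, hgG p hp]
        exact ⟨fun h => by rw [h], mul_left_cancel_of_isLoop⟩)
    intro t
    exact Set.eq_univ_iff_forall.1 hS t
  -- Comparing `f ((g s) θ(t))` with `f (g s) f (θ(t))` reduces `g s` to `s`, and conversely.
  have hS := hgen {s | ∀ t, f (s * t) = f s * f t} (fun t => by rw [one_mul, hf1, one_mul]) (by
    intro g hg s
    have e1 : ∀ t, f (g * s * innerMap g s t) = f g * f (s * t) := fun t => by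
      rw [mul_innerMap, hfG g hg]
    have e2 : ∀ t, f (g * s) * f (innerMap g s t) = f g * (f s * f t) := fun t => by
      rw [inter g hg, hfG g hg, mul_innerMap]
    constructor
    · intro h t
      obtain ⟨t, rfl⟩ := (innerMap g s).surjective t
      rw [e1, e2, h t]
    · intro h t
      exact mul_left_cancel_of_isLoop (by rw [← e1, ← e2, h]))
  exact Set.eq_univ_iff_forall.1 hS s t

/-! ### Associators with an entry in the second center -/

/-- The commutative automorphic loops of nilpotency class at most three. -/
class IsClassThree (L : Type v) [MulOneClass L] [IsLoop L] : Prop where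
  isCommAutomorphic : IsCommAutomorphic L
  nilpotentOfClassLE : NilpotentOfClassLE L 3

section

variable {L : Type v} [MulOneClass L]

theorem coe_center_mul (a b : Submonoid.center L) : ((a * b : Submonoid.center L) : L) = a * b :=
  rfl

theorem coe_center_one : ((1 : Submonoid.center L) : L) = 1 :=
  rfl

theorem center_comm (z : Submonoid.center L) (a : L) : (z : L) * a = a * z := (z.2.comm a).eq

theorem mul_center_assoc (z : Submonoid.center L) (a b : L) : a * b * (z : L) = a * (b * z) :=
  z.2.right_assoc a b

theorem mul_center_mul (z : Submonoid.center L) (a b : L) : a * (z : L) * b = a * b * z := by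
  rw [z.2.mid_assoc, center_comm, mul_center_assoc]

theorem mul_center_mul_center (z w : Submonoid.center L) (a : L) :
    a * (z : L) * w = a * ((z * w : Submonoid.center L) : L) := by
  rw [mul_center_assoc, coe_center_mul]

end

section Center

variable {L : Type v} [MulOneClass L] [IsLoop L]

theorem exists_mul_eq_one_of_mem_center {z : L} (hz : z ∈ Set.center L) :
    ∃ w ∈ Set.center L, z * w = 1 := by
  have hw := mul_ldiv z (1 : L)
  set w := ldiv z (1 : L)
  have hc : ∀ a, w * a = a * w := fun a => by
    apply mul_left_cancel_of_isLoop (a := z)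
    rw [hz.left_assoc, hw, one_mul, hz.left_assoc, (hz.comm a).eq, hz.mid_assoc, hw, mul_one]
  have hl : ∀ b c, w * (b * c) = w * b * c := fun b c => by
    apply mul_left_cancel_of_isLoop (a := z)
    rw [hz.left_assoc, hw, one_mul, hz.left_assoc, hz.left_assoc, hw, one_mul]
  refine ⟨w, ⟨hc, hl, fun a b => ?_⟩, hw⟩
  apply mul_left_cancel_of_isLoop (a := z)
  rw [← hc (a * b), hz.left_assoc, hw, one_mul, hz.left_assoc, (hz.comm a).eq, hz.mid_assoc,
    ← hc b, hz.left_assoc, hw, one_mul]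

/-- The center of a loop is an abelian group. -/
noncomputable instance : CommGroup (Submonoid.center L) :=
  letI : CommMonoid (Submonoid.center L) := Submonoid.center.commMonoid'
  commGroupOfIsUnit fun a => by
    obtain ⟨w, hw, h⟩ := exists_mul_eq_one_of_mem_center a.2
    have h' : a * ⟨w, hw⟩ = 1 := Subtype.ext h
    exact ⟨⟨a, ⟨w, hw⟩, h', by rw [mul_comm, h']⟩, rfl⟩

theorem mul_center_cancel {a : L} {z w : Submonoid.center L} : a * (z : L) = a * w ↔ z = w :=
  ⟨fun h => Subtype.ext (mul_left_cancel_of_isLoop h), fun h => by rw [h]⟩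

end Center

section SecondCenter

variable (L : Type v) [MulOneClass L] [IsLoop L]

/-- The second center of a commutative loop: the elements all of whose associators are central. -/
def secondCenter : Set L :=
  {u | ∀ b c, associator u b c ∈ Submonoid.center L ∧ associator b u c ∈ Submonoid.center L ∧
    associator b c u ∈ Submonoid.center L}

variable {L}

/-- The associators with an entry in the second center, as elements of the center. -/
noncomputable def assocLeft (u : secondCenter L) (b c : L) : Submonoid.center L :=
  ⟨associator u b c, (u.2 b c).1⟩

/-- The associator `(b, u, c)` as an element of the center. -/
noncomputable def assocMid (b : L) (u : secondCenter L) (c : L) : Submonoid.center L :=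
  ⟨associator b u c, (u.2 b c).2.1⟩

/-- The associator `(b, c, u)` as an element of the center. -/
noncomputable def assocRight (b c : L) (u : secondCenter L) : Submonoid.center L :=
  ⟨associator b c u, (u.2 b c).2.2⟩

theorem mul_assocLeft (u : secondCenter L) (b c : L) :
    (u : L) * b * c = u * (b * c) * assocLeft u b c :=
  (mul_associator _ _ _).symm

theorem mul_assocMid (b : L) (u : secondCenter L) (c : L) :
    b * (u : L) * c = b * (u * c) * assocMid b u c :=
  (mul_associator _ _ _).symm

theorem mul_assocRight (b c : L) (u : secondCenter L) :
    b * c * (u : L) = b * (c * u) * assocRight b c u :=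
  (mul_associator _ _ _).symm

/-- A multiplicative map to an abelian group kills associators. -/
theorem map_associator_eq_one {A : Type*} [CommGroup A] (f : L → A)
    (hf : ∀ a b, f (a * b) = f a * f b) (a b c : L) : f (associator a b c) = 1 := by
  have h := congrArg f (mul_associator a b c)
  simp only [hf, mul_assoc] at h
  simpa using h

theorem assocLeft_center (u : secondCenter L) (c : L) (z : L) (hz : z ∈ Submonoid.center L) :
    assocLeft u z c = 1 ∧ assocLeft u c z = 1 := by
  constructor <;> apply Subtype.ext
  · change associator (u : L) z c = 1
    rw [associator_eq_one_iff]
    exact (hz.mid_assoc _ _).symm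
  · change associator (u : L) c z = 1
    rw [associator_eq_one_iff]
    exact (hz.right_assoc _ _).symm

variable [IsClassThree L]

theorem comm (a b : L) : a * b = b * a := (IsClassThree.isCommAutomorphic (L := L)).1 a b

theorem innerMap_mul' (a b c d : L) : innerMap a b (c * d) = innerMap a b c * innerMap a b d :=
  innerMap_mul IsClassThree.isCommAutomorphic.2 a b c d

theorem associator_mem_secondCenter (a b c : L) : associator a b c ∈ secondCenter L := by
  have h0 : (1 : L) ∈ upperCentral L 0 := rfl
  have h1 : (1 : L) ∈ upperCentral L 1 := by
    rw [upperCentral_one_eq]; exact Set.one_mem_center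
  have ha : a ∈ upperCentral L 3 := by
    rw [IsClassThree.nilpotentOfClassLE (L := L)]
    exact Set.mem_univ a
  intro d e
  have := (mem_upperCentral_succ_iff comm h1).1 (ha b c).2.1 d e
  rwa [upperCentral_one_eq] at this

theorem assocLeft_mul_assocRight (u : secondCenter L) (b c : L) :
    assocLeft u b c * assocRight c b u = 1 := by
  have h : u * (b * c) * ((assocLeft u b c * assocRight c b u : Submonoid.center L) : L) =
      u * (b * c) * ((1 : Submonoid.center L) : L) := by
    rw [← mul_center_mul_center, ← mul_assocLeft, comm (u * b : L) c, comm (u : L) b,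
      ← mul_assocRight, comm c b, comm (b * c), coe_center_one, mul_one]
  exact mul_center_cancel.1 h

theorem assocMid_mul_assocMid (b : L) (u : secondCenter L) (c : L) :
    assocMid b u c * assocMid c u b = 1 := by
  have h : b * (u * c) * ((assocMid b u c * assocMid c u b : Submonoid.center L) : L) =
      b * (u * c) * ((1 : Submonoid.center L) : L) := by
    rw [← mul_center_mul_center, ← mul_assocMid, comm (b * u : L) c, comm b (u : L),
      ← mul_assocMid, comm c u, comm b (u * c), coe_center_one, mul_one]
  exact mul_center_cancel.1 h

/-- The identity `(c, u, b) (b, c, u) (u, b, c) = 1`, which is a consequence of commutativity. -/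
theorem assoc_cyclic (u : secondCenter L) (b c : L) :
    assocMid c u b * assocRight b c u * assocLeft u b c = 1 := by
  have h : c * (u * b) *
      ((assocMid c u b * assocRight b c u * assocLeft u b c : Submonoid.center L) : L) =
      c * (u * b) * ((1 : Submonoid.center L) : L) := by
    rw [← mul_center_mul_center, ← mul_center_mul_center, ← mul_assocMid, comm (c * u : L) b,
      ← mul_assocRight, comm (b * c) (u : L), ← mul_assocLeft, comm c (u * b), coe_center_one,
      mul_one]
  exact mul_center_cancel.1 h

theorem innerMap_secondCenter (a b : L) (u : secondCenter L) :
    innerMap a b u = u * assocLeft u b a := by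
  rw [innerMap_eq_iff, ← mul_center_assoc, comm (a * b), comm a b, ← mul_assocLeft, comm,
    comm (u : L)]

theorem innerMap_secondCenter_right (a c : L) (u : secondCenter L) :
    innerMap a u c = c * assocMid c u a := by
  rw [innerMap_eq_iff, ← mul_center_assoc, comm (a * u : L) c, comm a u, ← mul_assocMid, comm,
    comm c]

theorem innerMap_secondCenter_left (a c : L) (u : secondCenter L) :
    innerMap (u : L) a c = c * assocRight c a u := by
  rw [innerMap_eq_iff, ← mul_center_assoc, comm (u * a : L) c, comm (u : L) a, ← mul_assocRight,
    comm, comm c]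

/-- As the inner mapping of `c, b` is an automorphism, `(u u', b, c) = (u, b, c) (u', b, c)`. The
product is a separate variable `w`, which is assumed to lie in the second center. -/
theorem assocLeft_of_eq_mul {u u' w : secondCenter L} (h : (w : L) = u * u') (b c : L) :
    assocLeft w b c = assocLeft u b c * assocLeft u' b c := by
  have e := innerMap_mul' c b (u : L) u'
  rw [← h, innerMap_secondCenter, innerMap_secondCenter, innerMap_secondCenter, mul_center_mul,
    ← mul_center_assoc, mul_center_mul_center, ← h, mul_center_cancel] at e
  rw [e, mul_comm]

/-- `b ↦ (b, u, c)` is multiplicative, as the inner mapping of `c, u` is an automorphism. -/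
theorem assocMid_mul_left (b b' : L) (u : secondCenter L) (c : L) :
    assocMid (b * b') u c = assocMid b u c * assocMid b' u c := by
  have e := innerMap_mul' c (u : L) b b'
  rw [innerMap_secondCenter_right, innerMap_secondCenter_right, innerMap_secondCenter_right,
    mul_center_mul, ← mul_center_assoc, mul_center_mul_center, mul_center_cancel] at e
  rw [e, mul_comm]

/-- `b ↦ (b, c, u)` is multiplicative, as the inner mapping of `u, c` is an automorphism. -/
theorem assocRight_mul_left (b b' c : L) (u : secondCenter L) :
    assocRight (b * b') c u = assocRight b c u * assocRight b' c u := by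
  have e := innerMap_mul' (u : L) c b b'
  rw [innerMap_secondCenter_left, innerMap_secondCenter_left, innerMap_secondCenter_left,
    mul_center_mul, ← mul_center_assoc, mul_center_mul_center, mul_center_cancel] at e
  rw [e, mul_comm]

theorem assocLeft_mul_right (u : secondCenter L) (b c c' : L) :
    assocLeft u b (c * c') = assocLeft u b c * assocLeft u b c' := by
  have h := fun c => eq_inv_of_mul_eq_one_left (assocLeft_mul_assocRight u b c)
  rw [h, h, h, assocRight_mul_left, mul_inv]

theorem assocMid_mul_right (b : L) (u : secondCenter L) (c c' : L) :
    assocMid b u (c * c') = assocMid b u c * assocMid b u c' := by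
  have h := fun c => eq_inv_of_mul_eq_one_left (assocMid_mul_assocMid b u c)
  rw [h, h, h, assocMid_mul_left, mul_inv]

theorem assocLeft_mul_mid (u : secondCenter L) (b b' c : L) :
    assocLeft u (b * b') c = assocLeft u b c * assocLeft u b' c := by
  have h := fun b => eq_inv_of_mul_eq_one_right (assoc_cyclic u b c)
  rw [h, h, h, assocRight_mul_left, assocMid_mul_right, ← mul_inv, mul_mul_mul_comm]

end SecondCenter

/-! ### The associator kernel -/

section AssocKernel

variable (L : Type v) [MulOneClass L] [IsLoop L]

/-- The elements `z` of the second center with `(u, z, c) = (u, c, z) = 1` for all `u` in the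
second center and all `c`. They form an abelian group, written additively. -/
def AssocKernel : Type v :=
  {z : L // z ∈ secondCenter L ∧
    ∀ (u : secondCenter L) (c : L), assocLeft u z c = 1 ∧ assocLeft u c z = 1}

variable {L}

namespace AssocKernel

/-- The underlying element of the loop. -/
def val (k : AssocKernel L) : L := k.1

/-- The underlying element of the second center. -/
def toSecond (k : AssocKernel L) : secondCenter L := ⟨k.1, k.2.1⟩

theorem coe_toSecond (k : AssocKernel L) : (k.toSecond : L) = k.val := rfl

theorem ext {k l : AssocKernel L} (h : k.val = l.val) : k = l := Subtype.ext h

/-- Central elements, as elements of the associator kernel. -/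
def ofCenter (z : Submonoid.center L) : AssocKernel L :=
  ⟨z, fun b c => by
    have h1 : associator (z : L) b c = 1 := associator_eq_one_iff.2 (z.2.left_assoc _ _)
    have h2 : associator b (z : L) c = 1 := associator_eq_one_iff.2 (z.2.mid_assoc _ _).symm
    have h3 : associator b c (z : L) = 1 := associator_eq_one_iff.2 (z.2.right_assoc _ _).symm
    rw [h1, h2, h3]
    exact ⟨one_mem _, one_mem _, one_mem _⟩, fun u c => assocLeft_center u c z z.2⟩

theorem assoc_left_mid (u : secondCenter L) (k : AssocKernel L) (c : L) :
    (u : L) * k.val * c = u * (k.val * c) := by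
  rw [mul_assocLeft, val, (k.2.2 u c).1, coe_center_one, mul_one]

theorem assocLeft_one_mid (u : secondCenter L) (c : L) : assocLeft u 1 c = 1 :=
  (assocLeft_center u c 1 (one_mem _)).1

theorem assocLeft_one_right (u : secondCenter L) (c : L) : assocLeft u c 1 = 1 :=
  (assocLeft_center u c 1 (one_mem _)).2

instance : Zero (AssocKernel L) where
  zero := ofCenter 1

theorem val_zero : (0 : AssocKernel L).val = 1 := rfl

variable [IsClassThree L]

theorem mem_secondCenter_of_left_mid {w : L}
    (h1 : ∀ b c, ∃ z : Submonoid.center L, w * b * c = w * (b * c) * z)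
    (h2 : ∀ b c, ∃ z : Submonoid.center L, b * w * c = b * (w * c) * z) : w ∈ secondCenter L := by
  intro b c
  obtain ⟨z1, hz1⟩ := h1 b c
  obtain ⟨z2, hz2⟩ := h2 b c
  obtain ⟨z3, hz3⟩ := h1 c b
  have e1 : associator w b c = z1 := associator_eq_iff.2 hz1.symm
  have e2 : associator b w c = z2 := associator_eq_iff.2 hz2.symm
  have e3 : associator b c w = (z3⁻¹ : Submonoid.center L) := by
    rw [associator_eq_iff, comm c w, comm b (w * c), hz3, mul_center_mul_center, mul_inv_cancel,
      coe_center_one, mul_one, comm, comm c b]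
  rw [e1, e2, e3]
  exact ⟨z1.2, z2.2, z3⁻¹.2⟩

theorem assoc_mul_val (c : L) (k l : AssocKernel L) : c * k.val * l.val = c * (k.val * l.val) := by
  have := assoc_left_mid l.toSecond k c
  rw [coe_toSecond] at this
  rw [comm (c * k.val), comm c k.val, ← this, comm l.val, comm c]

noncomputable instance : Add (AssocKernel L) where
  add k l := ⟨k.val * l.val, by
    apply mem_secondCenter_of_left_mid
    · intro b c
      refine ⟨assocLeft l.toSecond b c * assocLeft k.toSecond (l.val * b) c, ?_⟩
      have h1 := assoc_left_mid k.toSecond l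
      rw [coe_toSecond] at h1
      have h2 := mul_assocLeft k.toSecond (l.val * b) c
      have h3 := mul_assocLeft l.toSecond b c
      rw [coe_toSecond] at h2 h3
      rw [h1, h2, h3, h1, ← mul_center_assoc, mul_center_mul_center]
    · intro b c
      refine ⟨assocMid b k.toSecond (l.val * c) * assocMid (b * k.val) l.toSecond c, ?_⟩
      have h1 := assoc_left_mid k.toSecond l c
      have h2 := mul_assocMid b k.toSecond (l.val * c)
      have h3 := mul_assocMid (b * k.val) l.toSecond c
      rw [coe_toSecond] at h1 h2 h3
      rw [← assoc_mul_val, h3, h2, mul_center_mul_center, h1], by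
    intro u c
    rw [assocLeft_mul_mid, assocLeft_mul_right, val, val, (k.2.2 u c).1, (k.2.2 u c).2,
      (l.2.2 u c).1, (l.2.2 u c).2, mul_one]
    exact ⟨rfl, rfl⟩⟩

theorem val_add (k l : AssocKernel L) : (k + l).val = k.val * l.val := rfl

noncomputable instance : Neg (AssocKernel L) where
  neg k := ⟨ldiv k.val 1, by
    have e : k.val * ldiv k.val 1 = 1 := mul_ldiv _ _
    have h1 : ∀ c, assocLeft k.toSecond (ldiv k.val 1) c = 1 := fun c => by
      have := assocLeft_mul_mid k.toSecond k.val (ldiv k.val 1) c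
      rwa [e, val, (k.2.2 _ c).1, one_mul, assocLeft_one_mid, eq_comm] at this
    -- `k` and its inverse associate with every element, since `(k, k⁻¹, b) = (k, k, b)⁻¹ = 1`.
    have h2 : ∀ b, k.val * (ldiv k.val 1 * b) = b := fun b => by
      have := mul_assocLeft k.toSecond (ldiv k.val 1) b
      rw [coe_toSecond, h1, coe_center_one, mul_one, e, one_mul] at this
      exact this.symm
    apply mem_secondCenter_of_left_mid
    · intro b c
      refine ⟨(assocLeft k.toSecond (ldiv k.val 1 * b) c)⁻¹, ?_⟩
      apply mul_left_cancel_of_isLoop (a := k.val)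
      have h3 := mul_assocLeft k.toSecond (ldiv k.val 1 * b) c
      rw [coe_toSecond, h2] at h3
      rw [← mul_center_assoc, h2, h3, mul_center_mul_center, mul_inv_cancel, coe_center_one,
        mul_one]
    · intro b c
      have h3 := mul_assocMid (b * ldiv k.val 1) k.toSecond (ldiv k.val 1 * c)
      rw [coe_toSecond, h2, comm (b * ldiv k.val 1) k.val, comm b, h2, comm _ b] at h3
      refine ⟨(assocMid (b * ldiv k.val 1) k.toSecond (ldiv k.val 1 * c))⁻¹, ?_⟩
      rw [h3, mul_center_mul_center, mul_inv_cancel, coe_center_one, mul_one], by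
    intro u c
    have e : k.val * ldiv k.val 1 = 1 := mul_ldiv _ _
    constructor
    · have := assocLeft_mul_mid u k.val (ldiv k.val 1) c
      rwa [e, val, (k.2.2 _ c).1, one_mul, assocLeft_one_mid, eq_comm] at this
    · have := assocLeft_mul_right u c k.val (ldiv k.val 1)
      rwa [e, val, (k.2.2 _ c).2, one_mul, assocLeft_one_right, eq_comm] at this⟩

theorem val_mul_val_neg (k : AssocKernel L) : k.val * (-k).val = 1 := mul_ldiv _ _

noncomputable instance : AddCommGroup (AssocKernel L) where
  add_assoc k l m := ext (assoc_mul_val _ _ _)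
  zero_add k := ext (one_mul _)
  add_zero k := ext (mul_one _)
  nsmul := nsmulRec
  zsmul := zsmulRec
  neg_add_cancel k := ext ((comm _ _).trans (val_mul_val_neg k))
  add_comm k l := ext (comm _ _)

/-- The associator kernel acts on the loop by multiplication. -/
noncomputable instance : AddAction (AssocKernel L) L where
  vadd k w := w * k.val
  zero_vadd w := mul_one w
  add_vadd k l w := by
    change w * (k + l).val = w * l.val * k.val
    rw [add_comm, val_add, assoc_mul_val]

theorem vadd_eq (k : AssocKernel L) (w : L) : k +ᵥ w = w * k.val := rfl

theorem vadd_right_inj {k l : AssocKernel L} {w : L} : k +ᵥ w = l +ᵥ w ↔ k = l :=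
  ⟨fun h => ext (mul_left_cancel_of_isLoop h), fun h => by rw [h]⟩

theorem eq_vadd_iff {k : AssocKernel L} {w : L} : w = k +ᵥ w ↔ k = 0 := by
  conv_lhs => lhs; rw [← zero_vadd (AssocKernel L) w]
  rw [vadd_right_inj, eq_comm]

theorem ofCenter_add_vadd (z : Submonoid.center L) (k : AssocKernel L) (w : L) :
    (k + ofCenter z) +ᵥ w = w * k.val * z := by
  rw [add_comm, add_vadd]; rfl

theorem ofCenter_mul (z w : Submonoid.center L) : ofCenter (z * w) = ofCenter z + ofCenter w := rfl

end AssocKernel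

open AssocKernel

variable [IsClassThree L]

/-- The associator `(k, b, c)` as an endomorphism of the associator kernel, in `k`. -/
noncomputable def assocHom (b c : L) : AssocKernel L →+ AssocKernel L where
  toFun k := ofCenter (assocLeft k.toSecond b c)
  map_zero' := by
    have h : assocLeft (0 : AssocKernel L).toSecond b c = 1 :=
      Subtype.ext (associator_eq_one_iff.2 (by
        rw [coe_toSecond, val_zero, one_mul, one_mul]))
    rw [h]; rfl
  map_add' k l := by
    rw [← ofCenter_mul, assocLeft_of_eq_mul (u := k.toSecond) (u' := l.toSecond) rfl]

theorem assocHom_apply (b c : L) (k : AssocKernel L) :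
    assocHom b c k = ofCenter (assocLeft k.toSecond b c) := rfl

theorem assocHom_mul_left (b b' c : L) :
    assocHom (b * b') c = assocHom b c + assocHom b' c := by
  ext k
  rw [AddMonoidHom.add_apply, assocHom_apply, assocLeft_mul_mid, ofCenter_mul]; rfl

theorem assocHom_mul_right (b c c' : L) :
    assocHom b (c * c') = assocHom b c + assocHom b c' := by
  ext k
  rw [AddMonoidHom.add_apply, assocHom_apply, assocLeft_mul_right, ofCenter_mul]; rfl

theorem assocHom_one_left (c : L) : assocHom 1 c = 0 := by
  have := assocHom_mul_left 1 1 c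
  rwa [mul_one, left_eq_add] at this

theorem assocHom_one_right (c : L) : assocHom c 1 = 0 := by
  have := assocHom_mul_right c 1 1
  rwa [mul_one, left_eq_add] at this

theorem assocHom_vadd_left (k : AssocKernel L) (b c : L) :
    assocHom (k +ᵥ b) c = assocHom b c := by
  ext l
  rw [vadd_eq, assocHom_mul_left, AddMonoidHom.add_apply, assocHom_apply k.val, val, (k.2.2 _ _).1]
  exact add_zero _

theorem assocHom_vadd_right (k : AssocKernel L) (b c : L) :
    assocHom b (k +ᵥ c) = assocHom b c := by
  ext l
  rw [vadd_eq, assocHom_mul_right, AddMonoidHom.add_apply, assocHom_apply _ k.val, val,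
    (k.2.2 _ _).2]
  exact add_zero _

theorem assocHom_ofCenter (b c : L) (z : Submonoid.center L) :
    assocHom b c (ofCenter z) = 0 :=
  congrArg ofCenter (Subtype.ext (associator_eq_one_iff.2 (z.2.left_assoc _ _)))

theorem assocHom_assocHom (b c b' c' : L) (k : AssocKernel L) :
    assocHom b c (assocHom b' c' k) = 0 :=
  assocHom_ofCenter _ _ _

/-- In `(a k) b`, moving `k` to the end costs the central factor `(k, a, b)`. -/
theorem vadd_mul_eq (k : AssocKernel L) (a b : L) :
    (k +ᵥ a) * b = (k + assocHom a b k) +ᵥ (a * b) := by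
  have h := mul_assocLeft k.toSecond a b
  rw [coe_toSecond] at h
  rw [vadd_eq, assocHom_apply, ofCenter_add_vadd, comm a k.val, h, comm k.val]

theorem mul_vadd_eq (k : AssocKernel L) (a b : L) :
    a * (k +ᵥ b) = (k + assocHom b a k) +ᵥ (a * b) := by
  rw [comm, vadd_mul_eq, comm]

/-- Associators, as elements of the associator kernel: a homomorphism to the abelian group of
central elements kills them. -/
noncomputable def assocK (a b c : L) : AssocKernel L :=
  ⟨associator a b c, associator_mem_secondCenter a b c, fun u d =>
    ⟨map_associator_eq_one (fun z => assocLeft u z d) (fun _ _ => assocLeft_mul_mid _ _ _ _) a b c,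
      map_associator_eq_one (fun z => assocLeft u d z) (fun _ _ => assocLeft_mul_right _ _ _ _)
        a b c⟩⟩

theorem mul_mul_eq_vadd (a b c : L) : a * b * c = assocK a b c +ᵥ (a * (b * c)) :=
  (mul_associator a b c).symm

theorem assocK_rev (a b c : L) : assocK c b a = -assocK a b c := by
  have h1 := mul_mul_eq_vadd a b c
  have h2 := mul_mul_eq_vadd c b a
  rw [comm _ c, comm a b] at h1
  rw [h1, comm (c * b) a, comm c b, vadd_vadd, eq_vadd_iff] at h2
  exact eq_neg_of_add_eq_zero_left h2

/-- Inner mappings move each element by an element of the associator kernel. -/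
theorem innerMap_eq_vadd (a b c : L) : innerMap a b c =
    (assocK c b a - assocHom c (a * b) (assocK c b a)) +ᵥ c := by
  rw [innerMap_eq_iff, mul_vadd_eq, map_sub, assocHom_assocHom, sub_zero, sub_add_cancel,
    comm a (b * c), comm b c, mul_mul_eq_vadd c b a, comm (a * b), comm a b]

theorem innerMap_vadd (a b c : L) (k : AssocKernel L) :
    innerMap a b (k +ᵥ c) = (k + assocHom b a k) +ᵥ innerMap a b c := by
  rw [vadd_eq, innerMap_mul', ← coe_toSecond, innerMap_secondCenter, assocHom_apply,
    ofCenter_add_vadd, mul_center_assoc]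
  rfl

theorem innerMap_self (a b : L) : innerMap a b a = a := by
  rw [innerMap_eq_iff, comm, comm a b]

theorem innerMap_conj (a b c d e : L) : innerMap a b (innerMap c d e) =
    innerMap (innerMap a b c) (innerMap a b d) (innerMap a b e) := by
  symm
  rw [innerMap_eq_iff, ← innerMap_mul', ← innerMap_mul', ← innerMap_mul', ← innerMap_mul',
    mul_innerMap]

end AssocKernel

/-! ### Powers and products of powers -/

theorem three_mul_α (n : ℤ) : 3 * α n = n ^ 3 - n := by
  refine Int.mul_ediv_cancel' ?_
  obtain ⟨k, rfl | rfl | rfl⟩ : ∃ k, n = 3 * k ∨ n = 3 * k + 1 ∨ n = 3 * k + 2 := ⟨n / 3, by omega⟩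
  · exact ⟨9 * k ^ 3 - k, by ring⟩
  · exact ⟨9 * k ^ 3 + 9 * k ^ 2 + 2 * k, by ring⟩
  · exact ⟨9 * k ^ 3 + 18 * k ^ 2 + 11 * k + 2, by ring⟩

theorem α_add (m n : ℤ) : α (m + n) = α m + α n + m * n * (m + n) := by
  apply mul_left_cancel₀ (three_ne_zero' ℤ)
  linear_combination three_mul_α (m + n) - three_mul_α m - three_mul_α n

theorem α_one : α 1 = 0 := by decide

/-- Two-sided induction on the integers. -/
theorem forall_of_iff_succ {P : ℤ → Prop} (h0 : P 0) (h : ∀ n, P n ↔ P (n + 1)) (n : ℤ) : P n := by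
  induction n using Int.induction_on with
  | zero => exact h0
  | succ n ih => exact (h _).1 ih
  | pred n ih => exact (h _).2 (by simpa using ih)

section Powers

variable {L : Type v} [MulOneClass L] [IsLoop L]

theorem lpow_zero (x : L) : lpow x 0 = 1 := by
  rw [lpow, zpow_zero]; rfl

theorem lpow_succ (x : L) (n : ℤ) : lpow x (n + 1) = x * lpow x n := by
  rw [lpow, zpow_add, zpow_one, ((Commute.refl _).zpow_left n).eq]; rfl

theorem lpow_one (x : L) : lpow x 1 = x := by
  have := lpow_succ x 0
  rwa [zero_add, lpow_zero, mul_one] at this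

theorem map_lpow {Q : Type u} [MulOneClass Q] [IsLoop Q] (f : Q → L) (h1 : f 1 = 1)
    (hf : ∀ a b, f (a * b) = f a * f b) (x : Q) (n : ℤ) : f (lpow x n) = lpow (f x) n := by
  induction n using forall_of_iff_succ with
  | h0 => rw [lpow_zero, lpow_zero, h1]
  | h n =>
    rw [lpow_succ, lpow_succ, hf]
    exact ⟨fun h => by rw [h], mul_left_cancel_of_isLoop⟩

end Powers

section ClassThree

open AssocKernel

variable {L : Type v} [MulOneClass L] [IsLoop L] [IsClassThree L]

theorem innerMap_lpow (a b x : L) (n : ℤ) : innerMap a b (lpow x n) = lpow (innerMap a b x) n :=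
  map_lpow _ (innerMap_one a b) (innerMap_mul' a b) x n

/-- Left translations by `x` and by its powers commute, because the inner mapping of `x, x ^ n`
fixes `x`. -/
theorem lpow_mul_left_comm (x w : L) (n : ℤ) : lpow x n * (x * w) = x * (lpow x n * w) := by
  revert w
  induction n using forall_of_iff_succ with
  | h0 => intro w; rw [lpow_zero, one_mul, one_mul]
  | h n =>
    rw [lpow_succ]
    have e : ∀ w, x * lpow x n * (x * innerMap x (lpow x n) w) = x * (lpow x n * (x * w)) :=
      fun w => by
      have h := innerMap_mul' x (lpow x n) x w
      rw [innerMap_self] at h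
      rw [← h, mul_innerMap]
    constructor
    · intro h w
      obtain ⟨w, rfl⟩ := (innerMap x (lpow x n)).surjective w
      rw [e, mul_innerMap, h]
    · intro h w
      have := h (innerMap x (lpow x n) w)
      rw [e, mul_innerMap] at this
      exact mul_left_cancel_of_isLoop this

theorem assocHom_lpow_left (x c : L) (n : ℤ) : assocHom (lpow x n) c = n • assocHom x c := by
  induction n using forall_of_iff_succ with
  | h0 => rw [lpow_zero, assocHom_one_left, zero_smul]
  | h n =>
    rw [lpow_succ, assocHom_mul_left, add_smul, one_smul, add_comm, add_left_inj]

theorem assocHom_lpow_right (x c : L) (n : ℤ) : assocHom c (lpow x n) = n • assocHom c x := by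
  induction n using forall_of_iff_succ with
  | h0 => rw [lpow_zero, assocHom_one_right, zero_smul]
  | h n =>
    rw [lpow_succ, assocHom_mul_right, add_smul, one_smul, add_comm, add_left_inj]

theorem lpow_vadd (k : AssocKernel L) (x : L) (n : ℤ) :
    lpow (k +ᵥ x) n = (n • k + α n • assocHom x x k) +ᵥ lpow x n := by
  induction n using forall_of_iff_succ with
  | h0 => simp [lpow_zero, α]
  | h n =>
    have e : (k +ᵥ x) * ((n • k + α n • assocHom x x k) +ᵥ lpow x n) =
        (((n + 1) • k + α (n + 1) • assocHom x x k) +ᵥ (x * lpow x n)) := by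
      rw [vadd_mul_eq, mul_vadd_eq, vadd_vadd, α_add, α_one]
      simp only [assocHom_vadd_right, map_add, map_zsmul, assocHom_assocHom,
        assocHom_lpow_left, assocHom_lpow_right, AddMonoidHom.smul_apply]
      congr 1
      module
    rw [lpow_succ, lpow_succ, ← e]
    exact ⟨fun h => by rw [h], mul_left_cancel_of_isLoop⟩

/-- `(k, y, x) = (k, x, y)` for `k = (x, x, y)`. The inner mapping `θ` of `x, y` fixes `x`, hence
commutes with the inner mapping `ψ` of `x, x`, and so `θ` is also the inner mapping of
`x, ψ y`, where `ψ y = y e` with `e` an inverse of `k` modulo the center. -/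
theorem assocHom_assocK_comm (x y : L) :
    assocHom x y (assocK x x y) = assocHom y x (assocK x x y) := by
  have h1 : ∀ c, innerMap x (innerMap x x y) c = innerMap x y c := by
    intro c
    obtain ⟨c, rfl⟩ := (innerMap x x).surjective c
    have e1 := innerMap_conj x x x y c
    have e2 := innerMap_conj x y x x c
    rw [innerMap_self] at e1 e2
    rw [← e1, ← e2]
  have h2 := mul_innerMap x (innerMap x x y) y
  rw [h1, innerMap_eq_vadd x y y, innerMap_eq_vadd x x y] at h2
  have h3 := mul_innerMap x y y
  rw [innerMap_eq_vadd x y y] at h3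
  rw [assocK_rev x x y] at h2
  simp only [vadd_mul_eq, mul_vadd_eq, assocHom_vadd_right, vadd_vadd, map_add, map_sub, map_neg,
    map_zero, assocHom_assocHom, assocHom_mul_left, assocHom_mul_right, AddMonoidHom.add_apply]
    at h2 h3
  rw [← h3, vadd_vadd, vadd_right_inj] at h2
  linear_combination (norm := module) -h2

/-- `((x, x, y), y, x) = ((x, y, y), x, x)`, by applying the inner mapping of `x, y` to the
associator `(x, x, y)`. -/
theorem assocHom_assocK_exchange (x y : L) :
    assocHom y x (assocK x x y) = assocHom x x (assocK x y y) := by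
  have h1 := congrArg (innerMap x y) (mul_mul_eq_vadd x x y)
  simp only [innerMap_vadd, innerMap_mul', innerMap_self] at h1
  rw [innerMap_eq_vadd x y y, assocK_rev x y y] at h1
  simp only [mul_vadd_eq, vadd_vadd, map_add, map_sub, map_neg, map_zero, assocHom_assocHom,
    assocHom_mul_left, assocHom_mul_right, AddMonoidHom.add_apply, mul_mul_eq_vadd x x y,
    vadd_right_inj] at h1
  linear_combination (norm := module) -h1

/-- The value of the inner mapping of `x, x` at `y ^ j`, computed as the `j`-th power of its value
at `y`. -/
theorem mul_mul_lpow (x y : L) (j : ℤ) :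
    x * (x * lpow y j) = (-(j • assocK x x y) - (2 * β j) • assocHom y x (assocK x x y)
      - α j • assocHom y y (assocK x x y)) +ᵥ (x * x * lpow y j) := by
  rw [← mul_innerMap, innerMap_lpow, innerMap_eq_vadd, assocK_rev x x y, lpow_vadd, mul_vadd_eq]
  simp only [map_add, map_sub, map_neg, map_zsmul, assocHom_assocHom, map_zero]
  simp only [assocHom_lpow_left, assocHom_mul_right, AddMonoidHom.smul_apply,
    AddMonoidHom.add_apply, β]
  congr 1
  module

/-- How `x` multiplies `x ^ i w`, if `x (x w) = (x x · w) n`: the hypothesis determines the value of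
the inner mapping of `w, x` at `x`, hence at `x ^ i`. -/
theorem mul_lpow_mul (x w : L) (n : AssocKernel L) (hn : x * (x * w) = n +ᵥ (x * x * w)) (i : ℤ) :
    x * (lpow x i * w) = (i • n + α i • assocHom x x n + β i • assocHom x (x * w) n) +ᵥ
      (lpow x (i + 1) * w) := by
  obtain ⟨d, hd⟩ : ∃ d : AssocKernel L, innerMap w x x = d +ᵥ x := ⟨_, innerMap_eq_vadd w x x⟩
  have h1 : d + assocHom x (x * w) d + n = 0 := by
    have h := mul_innerMap w x x
    rwa [hd, mul_vadd_eq, comm (w * x) x, comm w x, hn, comm (x * x) w, vadd_vadd, eq_comm,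
      eq_vadd_iff] at h
  have h2 : assocHom x (x * w) d = -assocHom x (x * w) n := by
    have h := congrArg (assocHom x (x * w)) h1
    rw [map_add, map_add, assocHom_assocHom, add_zero, map_zero] at h
    exact eq_neg_of_add_eq_zero_left h
  have h3 : d = assocHom x (x * w) n - n := by
    rw [h2] at h1
    linear_combination (norm := module) h1
  have h := mul_innerMap w x (lpow x i)
  rw [innerMap_lpow, hd, lpow_vadd, mul_vadd_eq, comm w x, comm (x * w) (lpow x i),
    lpow_mul_left_comm, ← lpow_succ, comm w] at h
  rw [← h, vadd_vadd, eq_vadd_iff, h3]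
  simp only [map_add, map_sub, map_zsmul, assocHom_assocHom, map_zero]
  simp only [assocHom_lpow_left, AddMonoidHom.smul_apply, β]
  module

/-- The product of `x` and `x ^ i y ^ j`. -/
theorem mul_lpow_mul_lpow (x y : L) (i j : ℤ) :
    x * (lpow x i * lpow y j) =
      (-((i * j) • assocK x x y) - (j * (α i + β i)) • assocHom x x (assocK x x y)
        - (j * β i + β j * (i ^ 2 + i)) • assocHom y x (assocK x x y)
        - (i * α j) • assocHom y y (assocK x x y)) +ᵥ (lpow x (i + 1) * lpow y j) := by
  rw [mul_lpow_mul x _ _ (mul_mul_lpow x y j)]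
  simp only [map_sub, map_neg, map_zsmul, assocHom_assocHom]
  simp only [assocHom_lpow_right, assocHom_mul_right, AddMonoidHom.smul_apply,
    AddMonoidHom.add_apply, assocHom_assocK_comm x y, β]
  congr 1
  module

end ClassThree

/-! ### Evaluation of exponents in a loop of class three -/

section FreeMap

open AssocKernel

variable {L : Type v} [MulOneClass L] [IsLoop L] [IsClassThree L]

/-- The product `u₁ ^ a₃ u₂ ^ a₄ v₁ ^ a₅ v₂ ^ a₆ v₃ ^ a₇ v₄ ^ a₈` in the associator kernel, where
`u₁ = (x, x, y)`, `u₂ = (x, y, y)`, `v₁ = (x, x, u₁)`, `v₂ = (x, x, u₂)`, `v₃ = (y, y, u₁)` and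
`v₄ = (y, y, u₂)`; here `(x, x, u) = -(u, x, x)` in additive notation. -/
noncomputable def kernelPart (x y : L) (a : Z8) : AssocKernel L :=
  a.c3 • assocK x x y + a.c4 • assocK x y y
    - a.c5 • assocHom x x (assocK x x y) - a.c6 • assocHom x x (assocK x y y)
    - a.c7 • assocHom y y (assocK x x y) - a.c8 • assocHom y y (assocK x y y)

/-- The value of the word with exponents `a` at `x, y`. -/
noncomputable def freeMap (x y : L) (a : Z8) : L :=
  kernelPart x y a +ᵥ (lpow x a.c1 * lpow y a.c2)

theorem vadd_mul_vadd (k l : AssocKernel L) (a b : L) :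
    (k +ᵥ a) * (l +ᵥ b) = (k + l + assocHom a b k + assocHom b a l) +ᵥ (a * b) := by
  rw [vadd_mul_eq, mul_vadd_eq, vadd_vadd, assocHom_vadd_right]
  congr 1
  abel

theorem freeMap_one (x y : L) : freeMap x y 1 = 1 := by
  change kernelPart x y ⟨0, 0, 0, 0, 0, 0, 0, 0⟩ +ᵥ (lpow x 0 * lpow y 0) = 1
  simp [kernelPart, lpow_zero]

theorem freeMap_x (x y : L) : freeMap x y Z8.x = x := by
  simp [freeMap, kernelPart, Z8.x, lpow_zero, lpow_one]

theorem freeMap_y (x y : L) : freeMap x y Z8.y = y := by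
  simp [freeMap, kernelPart, Z8.y, lpow_zero, lpow_one]

theorem assocHom_freeMap (x y : L) (a b : Z8) :
    assocHom (freeMap x y a) (freeMap x y b) = (a.c1 * b.c1) • assocHom x x +
      (a.c1 * b.c2) • assocHom x y + (a.c2 * b.c1) • assocHom y x +
      (a.c2 * b.c2) • assocHom y y := by
  simp only [freeMap, assocHom_vadd_left, assocHom_vadd_right, assocHom_mul_left,
    assocHom_mul_right, assocHom_lpow_left, assocHom_lpow_right]
  module

/-! Together with `assocHom_assocK_exchange`, the next three lemmas express the values of `(u₁, ·, ·)`
and `(u₂, ·, ·)` at `x, y` in terms of those at `x, x` and `y, y`. -/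

theorem assocHom_left_comm (x y : L) :
    assocHom x y (assocK x x y) = assocHom x x (assocK x y y) := by
  rw [assocHom_assocK_comm, assocHom_assocK_exchange]

theorem assocHom_right_comm (x y : L) :
    assocHom x y (assocK x y y) = assocHom y y (assocK x x y) := by
  have h := assocHom_assocK_exchange y x
  rwa [assocK_rev x y y, assocK_rev x x y, map_neg, map_neg, neg_inj] at h

theorem assocHom_right_swap (x y : L) :
    assocHom y x (assocK x y y) = assocHom y y (assocK x x y) := by
  have h := assocHom_assocK_comm y x
  rwa [assocK_rev x y y, map_neg, map_neg, neg_inj, assocHom_right_comm] at h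

theorem assocHom_kernelPart (x y : L) (a b c : Z8) :
    assocHom (freeMap x y b) (freeMap x y c) (kernelPart x y a) =
      (b.c1 * c.c1 * a.c3) • assocHom x x (assocK x x y) +
      (b.c1 * c.c1 * a.c4 + (b.c1 * c.c2 + b.c2 * c.c1) * a.c3) • assocHom x x (assocK x y y) +
      (b.c2 * c.c2 * a.c3 + (b.c1 * c.c2 + b.c2 * c.c1) * a.c4) • assocHom y y (assocK x x y) +
      (b.c2 * c.c2 * a.c4) • assocHom y y (assocK x y y) := by
  simp only [assocHom_freeMap, kernelPart, map_add, map_sub, map_zsmul, AddMonoidHom.add_apply,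
    AddMonoidHom.smul_apply, assocHom_assocHom,
    assocHom_left_comm x y, assocHom_assocK_exchange x y, assocHom_right_comm x y,
    assocHom_right_swap x y]
  module

/-- The exponents of the part of an element outside the associator kernel. -/
def topPart (a : Z8) : Z8 := ⟨a.c1, a.c2, 0, 0, 0, 0, 0, 0⟩

theorem freeMap_topPart (x y : L) (a : Z8) :
    freeMap x y (topPart a) = lpow x a.c1 * lpow y a.c2 := by
  simp [freeMap, kernelPart, topPart]

theorem kernelPart_mul (x y : L) (a b : Z8) :
    kernelPart x y (a * b) = kernelPart x y (topPart a * topPart b) + kernelPart x y a +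
      kernelPart x y b + assocHom (freeMap x y a) (freeMap x y b) (kernelPart x y a) +
      assocHom (freeMap x y b) (freeMap x y a) (kernelPart x y b) := by
  rw [assocHom_kernelPart, assocHom_kernelPart]
  change kernelPart x y (Z8.mul a b) = kernelPart x y (Z8.mul (topPart a) (topPart b)) + _ + _ + _ + _
  simp only [kernelPart, topPart, Z8.mul]
  module

/-- The map `freeMap` and the multiplication of exponents treat elements of the associator kernel
in the same way: whether `freeMap` is multiplicative on a pair depends only on the
first two exponents. -/
theorem freeMap_mul_iff (x y : L) (a b : Z8) :
    freeMap x y (a * b) = freeMap x y a * freeMap x y b ↔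
      freeMap x y (topPart a * topPart b) = freeMap x y (topPart a) * freeMap x y (topPart b) := by
  have h1 : freeMap x y (a * b) = (kernelPart x y a + kernelPart x y b +
      assocHom (freeMap x y a) (freeMap x y b) (kernelPart x y a) +
      assocHom (freeMap x y b) (freeMap x y a) (kernelPart x y b)) +ᵥ
        freeMap x y (topPart a * topPart b) := by
    rw [freeMap, kernelPart_mul, freeMap.eq_def x y (topPart a * topPart b), vadd_vadd]
    congr 1
    abel
  have h2 : freeMap x y a * freeMap x y b = (kernelPart x y a + kernelPart x y b +
      assocHom (freeMap x y a) (freeMap x y b) (kernelPart x y a) +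
      assocHom (freeMap x y b) (freeMap x y a) (kernelPart x y b)) +ᵥ
        (freeMap x y (topPart a) * freeMap x y (topPart b)) := by
    simp only [freeMap_topPart]
    simp only [freeMap, vadd_mul_vadd, assocHom_vadd_left, assocHom_vadd_right]
  rw [h1, h2, vadd_left_cancel_iff]

theorem freeMap_mul_of_trivial (x y : L) (a b : Z8) (h1 : a.c1 = 0) (h2 : a.c2 = 0) :
    freeMap x y (a * b) = freeMap x y a * freeMap x y b := by
  have e : topPart a = 1 := by
    rw [topPart, h1, h2]; rfl
  rw [freeMap_mul_iff, e, one_mul, freeMap_one, one_mul]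

theorem freeMap_mul_of_left (x y : L) (a b : Z8) (h1 : a.c1 = 1) (h2 : a.c2 = 0) :
    freeMap x y (a * b) = freeMap x y a * freeMap x y b := by
  have e : topPart a = Z8.x := by
    rw [topPart, h1, h2]; rfl
  rw [freeMap_mul_iff, e, freeMap_x, freeMap_topPart, mul_lpow_mul_lpow, add_comm b.c1]
  change freeMap x y (Z8.mul Z8.x (topPart b)) = _
  simp only [freeMap, kernelPart, Z8.mul, Z8.x, topPart, Z8.α_zero, Z8.β_zero, α_one, zero_add,
    show β 1 = 0 from rfl, assocHom_assocK_exchange x y]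
  congr 1
  module

theorem freeMap_mul_of_right (x y : L) (a b : Z8) (h1 : a.c1 = 0) (h2 : a.c2 = 1) :
    freeMap x y (a * b) = freeMap x y a * freeMap x y b := by
  have e : topPart a = Z8.y := by
    rw [topPart, h1, h2]; rfl
  rw [freeMap_mul_iff, e, freeMap_y, freeMap_topPart, comm (lpow x b.c1), mul_lpow_mul_lpow,
    add_comm b.c2, assocK_rev x y y, comm _ (lpow x b.c1)]
  change freeMap x y (Z8.mul Z8.y (topPart b)) = _
  simp only [freeMap, kernelPart, Z8.mul, Z8.y, topPart, Z8.α_zero, Z8.β_zero, α_one, zero_add,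
    show β 1 = 0 from rfl, assocHom_right_comm x y, map_neg]
  congr 1
  module

end FreeMap

/-! ### Inner mappings of the loop of exponents -/

namespace Z8

theorem mul_def (a b : Z8) : a * b = mul a b := rfl

theorem one_def : (1 : Z8) = ⟨0, 0, 0, 0, 0, 0, 0, 0⟩ := rfl

theorem mul_comm (a b : Z8) : a * b = b * a := mul_comm' a b

theorem cast_α (n : ℤ) : (α n : ℚ) = (n ^ 3 - n) / 3 := by
  rw [eq_div_iff (by norm_num)]
  exact_mod_cast (_root_.mul_comm _ _).trans (three_mul_α n)

theorem cast_β (n : ℤ) : (β n : ℚ) = n ^ 2 - n := by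
  simp [β]

/-- The value of the inner mapping `L_{ab}⁻¹ L_a L_b` at `c`. -/
def innerMapFormula (a b c : Z8) : Z8 where
  c1 := c.c1
  c2 := c.c2
  c3 := c.c3 + b.c1 * (a.c2 * c.c1 - a.c1 * c.c2)
  c4 := c.c4 + b.c2 * (a.c2 * c.c1 - a.c1 * c.c2)
  c5 := c.c5 + α a.c1 * b.c1 * c.c2 + α b.c1 * (a.c1 * c.c2 - a.c2 * c.c1)
    - α c.c1 * a.c2 * b.c1 + (1 - a.c1 * b.c1) * b.c1 * (a.c2 * c.c1 - a.c1 * c.c2)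
    + b.c1 * (a.c3 * c.c1 - a.c1 * c.c3)
  c6 := c.c6 + α a.c1 * b.c2 * c.c2 - α c.c1 * a.c2 * b.c2
    + (2 - a.c2 * b.c1 - a.c1 * a.c2 - 2 * a.c1 * b.c2 - b.c1 * b.c2) * b.c1 *
      (a.c2 * c.c1 - a.c1 * c.c2)
    - b.c1 * c.c1 * c.c2 * (a.c2 * c.c1 - a.c1 * c.c2)
    - b.c1 * (a.c1 * c.c4 - a.c4 * c.c1) - b.c2 * (a.c1 * c.c3 - a.c3 * c.c1)
    - b.c1 * (a.c2 * c.c3 - a.c3 * c.c2)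
  c7 := c.c7 + α c.c2 * a.c1 * b.c1 - α a.c2 * b.c1 * c.c1
    + (2 - a.c1 * b.c2 - a.c1 * a.c2 - 2 * a.c2 * b.c1 - b.c1 * b.c2) * b.c2 *
      (a.c2 * c.c1 - a.c1 * c.c2)
    - b.c2 * c.c1 * c.c2 * (a.c2 * c.c1 - a.c1 * c.c2)
    - b.c2 * (a.c1 * c.c4 - a.c4 * c.c1) - b.c2 * (a.c2 * c.c3 - a.c3 * c.c2)
    - b.c1 * (a.c2 * c.c4 - a.c4 * c.c2)
  c8 := c.c8 + α c.c2 * a.c1 * b.c2 + α b.c2 * (a.c1 * c.c2 - a.c2 * c.c1)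
    - α a.c2 * b.c2 * c.c1 + (1 - a.c2 * b.c2) * b.c2 * (a.c2 * c.c1 - a.c1 * c.c2)
    - b.c2 * (a.c2 * c.c4 - a.c4 * c.c2)

theorem innerMap_eq (a b c : Z8) : innerMap a b c = innerMapFormula a b c := by
  rw [innerMap_eq_iff]
  simp only [mul_def]
  ext <;> simp only [mul, innerMapFormula] <;> apply Int.cast_injective (α := ℚ) <;>
    push_cast [cast_α, cast_β] <;> ring

theorem isCommAutomorphic : IsCommAutomorphic Z8 := by
  refine ⟨mul_comm, isAutomorphic_of_innerMap_mul mul_comm fun a b c d => ?_⟩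
  simp only [innerMap_eq, mul_def]
  ext <;> simp only [mul, innerMapFormula] <;> apply Int.cast_injective (α := ℚ) <;>
    push_cast [cast_α, cast_β] <;> ring

end Z8

/-! ### Canonical words and associators -/

section

variable {Q : Type u} {L : Type v} [MulOneClass Q] [IsLoop Q] [MulOneClass L] [IsLoop L]

theorem map_associator (f : Q →* L) (a b c : Q) :
    f (associator a b c) = associator (f a) (f b) (f c) := by
  symm
  rw [associator_eq_iff, ← map_mul, ← map_mul, ← map_mul, mul_associator, map_mul, map_mul]

theorem map_canonicalWord (f : Q →* L) (x y : Q) (a : Z8) :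
    f (canonicalWord x y a) = canonicalWord (f x) (f y) a := by
  simp only [canonicalWord, map_mul, map_associator, map_lpow f (map_one f) (map_mul f)]

theorem lpow_eq_of_succ {x : L} {g : ℤ → L} (h0 : g 0 = 1) (h : ∀ n, g (n + 1) = x * g n) (n : ℤ) :
    lpow x n = g n := by
  induction n using forall_of_iff_succ with
  | h0 => rw [lpow_zero, h0]
  | h n =>
    rw [lpow_succ, h]
    exact ⟨fun h => by rw [h], mul_left_cancel_of_isLoop⟩

theorem lpow_mem {S : Set L} (hS : IsSubloop S) {x : L} (hx : x ∈ S) (n : ℤ) : lpow x n ∈ S := by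
  induction n using forall_of_iff_succ with
  | h0 => rw [lpow_zero]; exact hS.one_mem
  | h n =>
    rw [lpow_succ]
    refine ⟨fun h => hS.mul_mem _ hx _ h, fun h => ?_⟩
    have := hS.ldiv_mem _ hx _ h
    rwa [ldiv_eq_iff.2 rfl] at this

end

namespace Z8

theorem associator_c1 (a b c : Z8) : (associator a b c).c1 = 0 := by
  have h := congrArg c1 (mul_associator a b c)
  simp only [mul_def, mul] at h
  linarith

theorem associator_c2 (a b c : Z8) : (associator a b c).c2 = 0 := by
  have h := congrArg c2 (mul_associator a b c)
  simp only [mul_def, mul] at h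
  linarith

theorem associator_c3 (a b c : Z8) :
    (associator a b c).c3 = b.c1 * (a.c1 * c.c2 - a.c2 * c.c1) := by
  have h := congrArg c3 (mul_associator a b c)
  have h1 := associator_c1 a b c
  have h2 := associator_c2 a b c
  simp only [mul_def, mul] at h h1 h2
  rw [h1, h2] at h
  linear_combination h

theorem associator_c4 (a b c : Z8) :
    (associator a b c).c4 = b.c2 * (a.c1 * c.c2 - a.c2 * c.c1) := by
  have h := congrArg c4 (mul_associator a b c)
  have h1 := associator_c1 a b c
  have h2 := associator_c2 a b c
  simp only [mul_def, mul] at h h1 h2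
  rw [h1, h2] at h
  linear_combination h

theorem mul_c1 (a b : Z8) : (a * b).c1 = a.c1 + b.c1 := rfl

theorem mul_c2 (a b : Z8) : (a * b).c2 = a.c2 + b.c2 := rfl

theorem ldiv_c1 (a b : Z8) : (ldiv a b).c1 = b.c1 - a.c1 := by
  rw [eq_sub_iff_add_eq', ← mul_c1, mul_ldiv]

theorem ldiv_c2 (a b : Z8) : (ldiv a b).c2 = b.c2 - a.c2 := by
  rw [eq_sub_iff_add_eq', ← mul_c2, mul_ldiv]

theorem associator_xxy : associator x x y = ⟨0, 0, 1, 0, 0, 0, 0, 0⟩ :=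
  associator_eq_iff.2 rfl

theorem associator_xyy : associator x y y = ⟨0, 0, 0, 1, 0, 0, 0, 0⟩ :=
  associator_eq_iff.2 rfl

theorem lpow_x (n : ℤ) : lpow x n = ⟨n, 0, 0, 0, 0, 0, 0, 0⟩ := by
  refine lpow_eq_of_succ (g := fun n => (⟨n, 0, 0, 0, 0, 0, 0, 0⟩ : Z8)) rfl (fun n => ?_) n
  rw [mul_def]
  ext <;> simp [mul, x, add_comm, α_zero, β_zero]

theorem lpow_y (n : ℤ) : lpow y n = ⟨0, n, 0, 0, 0, 0, 0, 0⟩ := by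
  refine lpow_eq_of_succ (g := fun n => (⟨0, n, 0, 0, 0, 0, 0, 0⟩ : Z8)) rfl (fun n => ?_) n
  rw [mul_def]
  ext <;> simp [mul, y, add_comm, α_zero, β_zero]

theorem lpow_kernel (p q r s t u n : ℤ) : lpow (⟨0, 0, p, q, r, s, t, u⟩ : Z8) n =
    ⟨0, 0, n * p, n * q, n * r, n * s, n * t, n * u⟩ := by
  refine lpow_eq_of_succ (g := fun n => (⟨0, 0, n * p, n * q, n * r, n * s, n * t, n * u⟩ : Z8))
    (by simp [one_def]) (fun n => ?_) n
  rw [mul_def]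
  ext <;> simp [mul, α_zero, β_zero] <;> ring

theorem canonicalWord_eq (a : Z8) : canonicalWord x y a = a := by
  have h1 : associator x x (⟨0, 0, 1, 0, 0, 0, 0, 0⟩ : Z8) = ⟨0, 0, 0, 0, 1, 0, 0, 0⟩ :=
    associator_eq_iff.2 rfl
  have h2 : associator x x (⟨0, 0, 0, 1, 0, 0, 0, 0⟩ : Z8) = ⟨0, 0, 0, 0, 0, 1, 0, 0⟩ :=
    associator_eq_iff.2 rfl
  have h3 : associator y y (⟨0, 0, 1, 0, 0, 0, 0, 0⟩ : Z8) = ⟨0, 0, 0, 0, 0, 0, 1, 0⟩ :=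
    associator_eq_iff.2 rfl
  have h4 : associator y y (⟨0, 0, 0, 1, 0, 0, 0, 0⟩ : Z8) = ⟨0, 0, 0, 0, 0, 0, 0, 1⟩ :=
    associator_eq_iff.2 rfl
  simp only [canonicalWord, associator_xxy, associator_xyy, h1, h2, h3, h4, lpow_x, lpow_y,
    lpow_kernel, mul_def]
  ext <;> simp [mul, α_zero, β_zero]

/-! ### Nuclei and center -/

theorem assoc_of_trivial {a b c : Z8} (ha1 : a.c1 = 0) (ha2 : a.c2 = 0) (ha3 : a.c3 = 0)
    (ha4 : a.c4 = 0) : a * (b * c) = a * b * c := by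
  simp only [mul_def]
  ext <;> simp only [mul, ha1, ha2, ha3, ha4, α_zero, β_zero, zero_add] <;> ring

theorem assoc_mid_of_trivial {a b c : Z8} (hb1 : b.c1 = 0) (hb2 : b.c2 = 0) :
    a * (b * c) = a * b * c := by
  simp only [mul_def]
  ext <;> simp only [mul, hb1, hb2, α_zero, β_zero, zero_add, add_zero] <;> ring

/-- The necessity of the conditions on `a` is read off from `(a, x, y)`, `(a, x, x)` and
`(a, y, y)`. -/
theorem mem_leftNucleus_iff {a : Z8} :
    a ∈ leftNucleus Z8 ↔ a.c1 = 0 ∧ a.c2 = 0 ∧ a.c3 = 0 ∧ a.c4 = 0 := by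
  refine ⟨fun h => ?_, fun ⟨h1, h2, h3, h4⟩ b c =>
    associator_eq_one_iff.2 (assoc_of_trivial h1 h2 h3 h4)⟩
  have h1 : a.c1 = 0 := by
    have e := associator_c3 a x y
    rw [h x y] at e
    simpa [one_def, x, y, eq_comm] using e
  have h2 : a.c2 = 0 := by
    have e := associator_c3 a x x
    rw [h x x] at e
    simpa [one_def, x, h1, eq_comm] using e
  have h3 : a.c3 = 0 := by
    have e := congrArg c5 (associator_eq_one_iff.1 (h x x))
    simp only [mul_def, mul, x, h1, h2, α_zero, β_zero] at e
    linear_combination e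
  have h4 : a.c4 = 0 := by
    have e := congrArg c8 (associator_eq_one_iff.1 (h y y))
    simp only [mul_def, mul, y, h1, h2, α_zero, β_zero] at e
    linear_combination e
  exact ⟨h1, h2, h3, h4⟩

theorem mem_middleNucleus_iff {a : Z8} : a ∈ middleNucleus Z8 ↔ a.c1 = 0 ∧ a.c2 = 0 := by
  refine ⟨fun h => ?_, fun ⟨h1, h2⟩ b c => associator_eq_one_iff.2 (assoc_mid_of_trivial h1 h2)⟩
  have e1 := associator_c3 x a y
  have e2 := associator_c4 x a y
  rw [h x y] at e1 e2
  simp only [one_def, x, y] at e1 e2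
  constructor <;> linarith

theorem rightNucleus_eq : rightNucleus Z8 = leftNucleus Z8 := by
  ext a
  have e : ∀ b c, associator b c a = 1 ↔ associator a c b = 1 := fun b c => by
    rw [associator_eq_one_iff, associator_eq_one_iff, mul_comm b, mul_comm (b * c), mul_comm c a,
      mul_comm c b, eq_comm]
  exact ⟨fun h b c => (e c b).1 (h c b), fun h b c => (e b c).2 (h c b)⟩

theorem nucleus_eq : nucleus Z8 = leftNucleus Z8 := by
  ext a
  rw [nucleus, rightNucleus_eq]
  refine ⟨fun h => h.2, fun h => ⟨⟨h, ?_⟩, h⟩⟩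
  rw [mem_leftNucleus_iff] at h
  exact mem_middleNucleus_iff.2 ⟨h.1, h.2.1⟩

theorem center_eq : center Z8 = leftNucleus Z8 := by
  rw [center_eq_setCenter]
  ext a
  refine ⟨fun h b c => associator_eq_one_iff.2 (h.left_assoc b c),
    fun h => ⟨mul_comm a, fun b c => associator_eq_one_iff.1 (h b c), fun b c => ?_⟩⟩
  rw [← rightNucleus_eq] at h
  exact (associator_eq_one_iff.1 (h b c)).symm

/-! ### The associator subloop -/

theorem associatorSubloop_eq : associatorSubloop Z8 = {a | a.c1 = 0 ∧ a.c2 = 0} := by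
  apply Set.Subset.antisymm
  · refine Set.sInter_subset_of_mem ⟨⟨⟨⟨rfl, rfl⟩, ?_, ?_, ?_⟩, ?_⟩,
      fun a b c => ⟨associator_c1 a b c, associator_c2 a b c⟩⟩
    · rintro a ⟨h1, h2⟩ b ⟨h3, h4⟩
      exact ⟨by rw [mul_c1, h1, h3]; rfl, by rw [mul_c2, h2, h4]; rfl⟩
    · rintro a ⟨h1, h2⟩ b ⟨h3, h4⟩
      exact ⟨by rw [ldiv_c1, h1, h3]; rfl, by rw [ldiv_c2, h2, h4]; rfl⟩
    · rintro a ⟨h1, h2⟩ b ⟨h3, h4⟩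
      have e := rdiv_mul a b
      have e1 := congrArg c1 e
      have e2 := congrArg c2 e
      rw [mul_c1, h1, h3, add_zero] at e1
      rw [mul_c2, h2, h4, add_zero] at e2
      exact ⟨e1, e2⟩
    · rintro φ hφ a ⟨h1, h2⟩
      exact ⟨(character_innerMapping_apply c1 mul_c1 hφ a).trans h1,
        (character_innerMapping_apply c2 mul_c2 hφ a).trans h2⟩
  · rintro a ⟨h1, h2⟩ S ⟨⟨hS, -⟩, hA⟩
    rw [← canonicalWord_eq a, canonicalWord, h1, h2, lpow_zero, lpow_zero, one_mul, one_mul]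
    have hp := fun p q r n => lpow_mem hS (hA p q r) n
    have hm := fun {p q} hp hq => hS.mul_mem p hp q hq
    exact hm (hm (hp ..) (hp ..)) (hm (hm (hm (hp ..) (hp ..)) (hp ..)) (hp ..))

/-! ### Freeness -/

theorem mem_upperCentral_one_iff {a : Z8} :
    a ∈ upperCentral Z8 1 ↔ a.c1 = 0 ∧ a.c2 = 0 ∧ a.c3 = 0 ∧ a.c4 = 0 := by
  rw [upperCentral_one, center_eq, mem_leftNucleus_iff]

theorem mem_upperCentral_two_iff {a : Z8} :
    a ∈ upperCentral Z8 2 ↔ a.c1 = 0 ∧ a.c2 = 0 := by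
  rw [mem_upperCentral_succ_iff mul_comm (mem_upperCentral_one_iff.2 ⟨rfl, rfl, rfl, rfl⟩)]
  simp only [mem_upperCentral_one_iff, associator_c1, associator_c2, associator_c3, associator_c4]
  constructor
  · intro h
    have e1 := (h x y).2.1.2.2.1
    have e2 := (h x y).2.1.2.2.2
    simp only [x, y] at e1 e2
    constructor <;> linarith
  · rintro ⟨h1, h2⟩ b c
    simp [h1, h2]

theorem nilpotentOfClass : NilpotentOfClass Z8 3 := by
  constructor
  · intro h
    have hx : x ∈ upperCentral Z8 2 := h.symm ▸ Set.mem_univ x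
    exact one_ne_zero (mem_upperCentral_two_iff.1 hx).1
  · refine Set.eq_univ_of_forall fun a => ?_
    rw [mem_upperCentral_succ_iff mul_comm (mem_upperCentral_two_iff.2 ⟨rfl, rfl⟩)]
    simp [mem_upperCentral_two_iff, associator_c1, associator_c2]

/-- The elements whose first two exponents are `(0, 0)`, `(1, 0)` or `(0, 1)`. -/
def generators : Set Z8 :=
  {a | (a.c1 = 0 ∧ a.c2 = 0) ∨ (a.c1 = 1 ∧ a.c2 = 0) ∨ (a.c1 = 0 ∧ a.c2 = 1)}

theorem eq_univ_of_generators (S : Set Z8) (h1 : 1 ∈ S)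
    (h : ∀ g ∈ generators, ∀ s, s ∈ S ↔ g * s ∈ S) : S = Set.univ := by
  have hx := h x (Or.inr (Or.inl ⟨rfl, rfl⟩))
  have hy := h y (Or.inr (Or.inr ⟨rfl, rfl⟩))
  have key1 : ∀ n : ℤ, ∀ a : Z8, a.c1 = 0 → a.c2 = n → a ∈ S := by
    intro n
    induction n using forall_of_iff_succ with
    | h0 =>
      intro a e1 e2
      rw [← mul_one a]
      exact (h a (Or.inl ⟨e1, e2⟩) 1).1 h1
    | h n =>
      refine ⟨fun ih a e1 e2 => ?_, fun ih a e1 e2 => (hy a).2 (ih _ ?_ ?_)⟩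
      · rw [← mul_ldiv y a]
        refine (hy _).1 (ih _ ?_ ?_)
        · rw [ldiv_c1, e1]; rfl
        · rw [ldiv_c2, e2]; exact add_sub_cancel_right n 1
      · rw [mul_c1, e1]; rfl
      · rw [mul_c2, e2]; exact add_comm 1 n
  have key2 : ∀ n : ℤ, ∀ a : Z8, a.c1 = n → a ∈ S := by
    intro n
    induction n using forall_of_iff_succ with
    | h0 => exact fun a e1 => key1 _ a e1 rfl
    | h n =>
      refine ⟨fun ih a e1 => ?_, fun ih a e1 => (hx a).2 (ih _ ?_)⟩
      · rw [← mul_ldiv x a]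
        refine (hx _).1 (ih _ ?_)
        rw [ldiv_c1, e1]; exact add_sub_cancel_right n 1
      · rw [mul_c1, e1]; exact add_comm 1 n
  exact Set.eq_univ_of_forall fun a => key2 _ a rfl

/-- The homomorphism to a commutative automorphic loop of class at most three with prescribed
values at `x` and `y`. -/
noncomputable def lift {L : Type v} [MulOneClass L] [IsLoop L] [IsClassThree L] (a b : L) :
    Z8 →* L where
  toFun := freeMap a b
  map_one' := freeMap_one a b
  map_mul' := map_mul_of_generating isCommAutomorphic IsClassThree.isCommAutomorphic _
    (freeMap_one a b) generators
    (by
      rintro g (⟨h1, h2⟩ | ⟨h1, h2⟩ | ⟨h1, h2⟩) t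
      · exact freeMap_mul_of_trivial a b g t h1 h2
      · exact freeMap_mul_of_left a b g t h1 h2
      · exact freeMap_mul_of_right a b g t h1 h2)
    (by
      intro φ hφ g hg
      simpa only [generators, Set.mem_ofPred_eq, character_innerMapping_apply c1 mul_c1 hφ,
        character_innerMapping_apply c2 mul_c2 hφ] using hg)
    eq_univ_of_generators

theorem isFreeOn : IsFreeOn.{0, v} 3 x y := by
  refine ⟨isCommAutomorphic, nilpotentOfClass, fun L _ _ hL hn a b => ?_⟩
  have : IsClassThree L := ⟨hL, hn⟩
  refine ⟨lift a b, ⟨freeMap_x a b, freeMap_y a b⟩, fun g ⟨hx, hy⟩ => ?_⟩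
  ext t
  rw [← canonicalWord_eq t, map_canonicalWord, map_canonicalWord, hx, hy]
  congr 1
  · exact (freeMap_x a b).symm
  · exact (freeMap_y a b).symm

end Z8

end CALoop

/-- The loop `(ℤ ^ 8, *)` is the free commutative automorphic loop of nilpotency class `3` on
`x`, `y`, with each element of this loop identified with the exponents of its canonical word,
and its associator subloop, nuclei and center are as stated. -/
theorem mainTheorem3 :
    (CALoop.IsFreeOn.{0, v} 3 CALoop.Z8.x CALoop.Z8.y ∧
      ∀ a : CALoop.Z8, CALoop.canonicalWord CALoop.Z8.x CALoop.Z8.y a = a) ∧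
    (CALoop.associatorSubloop CALoop.Z8 = CALoop.middleNucleus CALoop.Z8 ∧
      CALoop.middleNucleus CALoop.Z8 = {a : CALoop.Z8 | a.c1 = 0 ∧ a.c2 = 0}) ∧
    (CALoop.leftNucleus CALoop.Z8 = CALoop.rightNucleus CALoop.Z8 ∧
      CALoop.rightNucleus CALoop.Z8 = CALoop.nucleus CALoop.Z8 ∧
      CALoop.nucleus CALoop.Z8 = CALoop.center CALoop.Z8 ∧
      CALoop.center CALoop.Z8 =
        {a : CALoop.Z8 | a.c1 = 0 ∧ a.c2 = 0 ∧ a.c3 = 0 ∧ a.c4 = 0}) := by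
  have hm : CALoop.middleNucleus CALoop.Z8 = {a : CALoop.Z8 | a.c1 = 0 ∧ a.c2 = 0} :=
    Set.ext fun _ => CALoop.Z8.mem_middleNucleus_iff
  refine ⟨⟨CALoop.Z8.isFreeOn, CALoop.Z8.canonicalWord_eq⟩,
    ⟨CALoop.Z8.associatorSubloop_eq.trans hm.symm, hm⟩, CALoop.Z8.rightNucleus_eq.symm, ?_, ?_, ?_⟩
  · rw [CALoop.Z8.rightNucleus_eq, CALoop.Z8.nucleus_eq]
  · rw [CALoop.Z8.nucleus_eq, CALoop.Z8.center_eq]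
  · rw [CALoop.Z8.center_eq]
    exact Set.ext fun _ => CALoop.Z8.mem_leftNucleus_iff
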